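/- **Graphs.** Graphs are finite and may have loops and multiple edges. An *abstract crater* is a single vertex with two loops, a cycle graph (of length $1$: a vertex with one loop; of length $2$: two vertices joined by two edges; and so on), or a single vertex without loops. For $l\ge 1$ and $d\ge 0$, an *abstract $l$-volcano of depth $d$* is a finite undirected graph $X$ with a partition $\mathbb V(X)=V_0\sqcup\dots\sqcup V_d$ such that: the subgraph induced by $V_0$ (the *crater*) is an abstract crater; if $d\ge 1$, every vertex of $V_0\sqcup\dots\sqcup V_{d-1}$ has degree $l+1$ and every vertex of $V_d$ has degree $1$ (a loop counts once in the degree); if $u\in V_r$ and $v\in V_s$ are adjacent then $|r-s|\le 1$; for $0<r\le d$ the subgraph induced by $V_r$ has no edges, and each vertex of $V_r$ has exactly one edge to a vertex of $V_{r-1}$. **Iwasawa invariants.** Let $p$ be a prime and $Y$ a finite connected directed graph. For $a\in\mathbb Z_p^\times$ let $Y_n$ be the directed graph with vertex set $\mathbb V(Y)\times\mathbb Z/p^n$ and edge set $\mathbb E(Y)\times\mathbb Z/p^n$, where $(e,\sigma)$ goes from $(s,\sigma)$ to $(t,\sigma+a)$ if $e$ goes from $s$ to $t$. Connected components and spanning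 trees of directed graphs are those of the underlying undirected graphs. Suppose that the number of connected components of $Y_n$ is eventually constant, let $n_0$ be the least level from which on it is constant, let $\hat Y_{n_0}$ be a connected component of $Y_{n_0}$, and for $m\ge 0$ let $\kappa_m$ be the number of spanning trees of the preimage of $\hat Y_{n_0}$ in $Y_{n_0+m}$. Then $\mu(Y)$ and $\lambda(Y)$ are the integers such that, for some integer $\nu$, $\operatorname{ord}_p(\kappa_m)=\mu(Y)\,p^m+\lambda(Y)\,m+\nu$ for all sufficiently large $m$. **Statement.** Let $X$ be an abstract $l$-volcano whose crater is either a cycle graph of length $k\ge 2$, or a single vertex with two loops, in which case put $k=1$. Let $\tilde X$ be the directed graph with $\mathbb V(\tilde X)=\mathbb V(X)$ whose edges are obtained by giving each edge of $X$ an arbitrary orientation and adding, for each edge that is not a loop, one further edge in the opposite direction. Let $p$ be a prime that is coprime to $2kl$. Then, for every choice of $a\in\mathbb Z_p^\times$ and of the component $\hat{\tilde X}_{n_0}$, the invariants above are defined and $$\mu(\tilde X)=0,\qquad \lambda(\tilde X)=1 .$$ -/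

import Mathlib

/-! ### Undirected multigraphs: connectedness, trees, spanning trees -/

/-- Two vertices are joined by a walk. -/
def Graph.Reach {V E : Type*} (G : Graph V E) (x y : V) : Prop :=
  Relation.ReflTransGen G.Adj x y

/-- A graph is connected if it is nonempty and any two vertices are joined by a walk. -/
def Graph.IsConn {V E : Type*} (G : Graph V E) : Prop :=
  G.vertexSet.Nonempty ∧ ∀ x ∈ G.vertexSet, ∀ y ∈ G.vertexSet, G.Reach x y

/-- The vertex sets of the connected components of `G`. -/
def Graph.components {V E : Type*} (G : Graph V E) : Set (Set V) :=
  {S | ∃ x ∈ G.vertexSet, S = {y | y ∈ G.vertexSet ∧ G.Reach x y}}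

/-- `G` is a cycle graph of length `k ≥ 1`: its distinct vertices are `v i` and its distinct edges
are `e i`, `i ∈ ℤ/k`, with `e i` joining `v i` to `v (i + 1)`. For `k = 1` this is a vertex with
one loop, for `k = 2` it is a pair of vertices with two edges between them. -/
def Graph.IsCycleGraph {V E : Type*} (G : Graph V E) (k : ℕ) : Prop :=
  1 ≤ k ∧ ∃ (v : ZMod k → V) (e : ZMod k → E),
    Function.Injective v ∧ Set.range v = G.vertexSet ∧
    Function.Injective e ∧ Set.range e = G.edgeSet ∧
    ∀ i, G.IsLink (e i) (v i) (v (i + 1))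

/-- A tree is a connected graph none of whose subgraphs is a cycle. -/
def Graph.IsTreeGraph {V E : Type*} (G : Graph V E) : Prop :=
  G.IsConn ∧ ∀ (H : Graph V E) (k : ℕ), H ≤ G → ¬ H.IsCycleGraph k

/-- The number of spanning trees of `G`. -/
noncomputable def Graph.numSpanningTrees {V E : Type*} (G : Graph V E) : ℕ :=
  {T : Graph V E | T.IsSpanningSubgraph G ∧ T.IsTreeGraph}.ncard

/-- The degree of a vertex, where every loop counts once. -/
noncomputable def Graph.loopOnceDegree {V E : Type*} (G : Graph V E) (x : V) : ℕ :=
  (G.incidenceSet x).ncard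

/-! ### Abstract volcanoes -/

/-- `G` is a single vertex together with `m` loops. -/
def Graph.IsVertexWithLoops {V E : Type*} (G : Graph V E) (m : ℕ) : Prop :=
  (∃ v, G.vertexSet = {v}) ∧ G.edgeSet.Finite ∧ G.edgeSet.ncard = m

/-- An abstract crater: a vertex with two loops, a cycle graph, or a vertex without loops. -/
def Graph.IsAbstractCrater {V E : Type*} (G : Graph V E) : Prop :=
  G.IsVertexWithLoops 2 ∨ (∃ k, G.IsCycleGraph k) ∨ G.IsVertexWithLoops 0

/-- The crater of a graph equipped with a level function: the subgraph induced by the vertices of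
level `0`. -/
def Graph.crater {V E : Type*} (X : Graph V E) (level : V → ℕ) : Graph V E :=
  X.induce {v | v ∈ X.vertexSet ∧ level v = 0}

/-- `X` is an abstract `l`-volcano of depth `d`, where `V_r` is the set of vertices of
level `r`. -/
structure Graph.IsAbstractVolcano {V E : Type*} (X : Graph V E) (l d : ℕ) (level : V → ℕ) :
    Prop where
  finite_vertexSet : X.vertexSet.Finite
  finite_edgeSet : X.edgeSet.Finite
  l_pos : 0 < l
  level_le : ∀ v ∈ X.vertexSet, level v ≤ d
  crater : (X.crater level).IsAbstractCrater
  degree_lt : 1 ≤ d → ∀ v ∈ X.vertexSet, level v < d → X.loopOnceDegree v = l + 1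
  degree_eq : 1 ≤ d → ∀ v ∈ X.vertexSet, level v = d → X.loopOnceDegree v = 1
  adj_level : ∀ u v, X.Adj u v → level u ≤ level v + 1 ∧ level v ≤ level u + 1
  totally_disconnected : ∀ u v, 0 < level u → level u = level v → ¬ X.Adj u v
  existsUnique_up : ∀ v ∈ X.vertexSet, 0 < level v →
    ∃! e, ∃ u, X.IsLink e v u ∧ level u + 1 = level v

/-! ### Directed multigraphs, derived graphs -/

/-- A directed multigraph with vertices `V` and edges `E`. -/
structure DiMultigraph (V E : Type*) where
  src : E → V
  tgt : E → V

/-- The forgetful map to undirected multigraphs. -/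
def DiMultigraph.toGraph {V E : Type*} (D : DiMultigraph V E) : Graph V E where
  vertexSet := Set.univ
  edgeSet := Set.univ
  IsLink e x y := (D.src e = x ∧ D.tgt e = y) ∨ (D.src e = y ∧ D.tgt e = x)
  isLink_symm := fun _ _ => ⟨fun _ _ h => h.symm⟩
  eq_or_eq_of_isLink_of_isLink := by grind
  edge_mem_iff_exists_isLink := fun e =>
    ⟨fun _ => ⟨D.src e, D.tgt e, Or.inl ⟨rfl, rfl⟩⟩, fun _ => Set.mem_univ e⟩
  left_mem_of_isLink := fun _ _ _ _ => Set.mem_univ _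

/-- The derived graph of a voltage assignment `α` with values in an (additively written)
group `G`: the edge `(e, σ)` goes from `(s, σ)` to `(t, σ + α e)` if `e` goes from `s` to `t`. -/
def DiMultigraph.derived {V E G : Type*} [AddGroup G] (D : DiMultigraph V E) (α : E → G) :
    DiMultigraph (V × G) (E × G) where
  src e := (D.src e.1, e.2)
  tgt e := (D.tgt e.1, e.2 + α e.1)

/-- The graph obtained from `D` by adding, for each edge that is not a loop, an edge in the
opposite direction. -/
def DiMultigraph.double {V E : Type*} (D : DiMultigraph V E) :
    DiMultigraph V (E ⊕ {e : E // D.src e ≠ D.tgt e}) where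
  src := Sum.elim D.src (fun e => D.tgt e)
  tgt := Sum.elim D.tgt (fun e => D.src e)

/-- `D` is obtained from the undirected graph `X` by choosing an orientation of each edge. -/
def DiMultigraph.IsOrientationOf {V E : Type*} {X : Graph V E}
    (D : DiMultigraph X.vertexSet X.edgeSet) : Prop :=
  ∀ e : X.edgeSet, X.IsLink e (D.src e) (D.tgt e)

/-! ### Constant `ℤ_p`-towers and their Iwasawa invariants -/

/-- The undirected graph underlying `X_n`, the derived graph over `ℤ/p^n` of the constant
`ℤ_p`-valued voltage assignment with parameter `a`. -/
noncomputable def DiMultigraph.layer {V E : Type*} (D : DiMultigraph V E) (p : ℕ) [Fact p.Prime]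
    (a : ℤ_[p]) (n : ℕ) : Graph (V × ZMod (p ^ n)) (E × ZMod (p ^ n)) :=
  (D.derived (fun _ : E => PadicInt.toZModPow n a)).toGraph

/-- The part of `X_{n₀+m}` lying over the set `C` of vertices of `X_{n₀}`. -/
noncomputable def DiMultigraph.layerOver {V E : Type*} (D : DiMultigraph V E) (p : ℕ)
    [Fact p.Prime] (a : ℤ_[p]) (n₀ : ℕ) (C : Set (V × ZMod (p ^ n₀))) (m : ℕ) :
    Graph (V × ZMod (p ^ (n₀ + m))) (E × ZMod (p ^ (n₀ + m))) :=
  (D.layer p a (n₀ + m)).induce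
    {x | (x.1, ZMod.castHom (pow_dvd_pow p (Nat.le_add_right n₀ m)) (ZMod (p ^ n₀)) x.2) ∈ C}

/-- `n₀` is the least level from which on the number of connected components of `X_n` is
constant. -/
def DiMultigraph.IsStableLevel {V E : Type*} (D : DiMultigraph V E) (p : ℕ) [Fact p.Prime]
    (a : ℤ_[p]) (n₀ : ℕ) : Prop :=
  IsLeast {m | ∀ n, m ≤ n →
    (D.layer p a n).components.ncard = (D.layer p a m).components.ncard} n₀

/-- `μ` and `lam` are the Iwasawa invariants of a sequence of positive integers `κ`:
`ord_p (κ n) = μ p^n + lam n + ν` for some integer `ν` and all large `n`. -/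
def IsIwasawaPair (p : ℕ) (κ : ℕ → ℕ) (μ lam : ℤ) : Prop :=
  ∃ ν : ℤ, ∀ᶠ n in Filter.atTop,
    κ n ≠ 0 ∧ (padicValNat p (κ n) : ℤ) = μ * (p : ℤ) ^ n + lam * (n : ℤ) + ν

/-- The Iwasawa invariants of a sequence are unique. -/
theorem IsIwasawaPair.unique {p : ℕ} (hp : p.Prime) {κ : ℕ → ℕ} {μ lam μ' lam' : ℤ}
    (h : IsIwasawaPair p κ μ lam) (h' : IsIwasawaPair p κ μ' lam') : μ = μ' ∧ lam = lam' := by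
  obtain ⟨ν, h⟩ := h
  obtain ⟨ν', h'⟩ := h'
  obtain ⟨N, hN⟩ := Filter.eventually_atTop.1 (h.and h')
  have key : ∀ n, N ≤ n →
      (μ - μ') * (p : ℤ) ^ n + (lam - lam') * (n : ℤ) + (ν - ν') = 0 := by
    intro n hn
    have := hN n hn
    linarith [this.1.2, this.2.2]
  have h0 := key N le_rfl
  have h1 := key (N + 1) (by omega)
  have h2 := key (N + 2) (by omega)
  push_cast at h1 h2
  have hp1 : (p : ℤ) - 1 ≠ 0 := by
    have := hp.two_le
    omega
  have hp0 : (p : ℤ) ^ N ≠ 0 := pow_ne_zero _ (by exact_mod_cast hp.ne_zero)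
  have hA : (μ - μ') * ((p : ℤ) ^ N * ((p : ℤ) - 1) ^ 2) = 0 := by
    linear_combination h2 - 2 * h1 + h0
  have hμ : μ - μ' = 0 :=
    (mul_eq_zero.1 hA).resolve_right (mul_ne_zero hp0 (pow_ne_zero _ hp1))
  rw [hμ] at h0 h1
  exact ⟨by omega, by linarith⟩

/-- `μ(D) = μ` and `λ(D) = lam`: the directed graph `D` is connected, and for every constant
voltage assignment with a parameter `a ∈ ℤ_p^×` the number of components of the derived graphs
stabilizes from a least level `n₀` on, and for every component `C` of `X_{n₀}` the tower formed by
the parts of the `X_n`, `n ≥ n₀`, over `C` (a `ℤ_p`-tower whose bottom layer is `C`) has Iwasawa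
invariants `μ` and `lam`. -/
def DiMultigraph.HasIwasawaInvariants {V E : Type*} (D : DiMultigraph V E) (p : ℕ)
    [Fact p.Prime] (μ lam : ℤ) : Prop :=
  D.toGraph.IsConn ∧
  ∀ a : ℤ_[p], IsUnit a → ∃ n₀, D.IsStableLevel p a n₀ ∧
    ∀ C ∈ (D.layer p a n₀).components,
      IsIwasawaPair p (fun m => (D.layerOver p a n₀ C m).numSpanningTrees) μ lam

/-! Let A be the matrix of edge multiplicities of X (a loop counting once), Δ = diag(A1) − A and q =
p^n. Every edge that is not a loop occurs in both directions, so the Laplacian of the n-th layer is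
the block matrix 2Δ + A(2 − P − P⁻¹), where P is the translation of ℤ/q by the image of a. Its
blocks are polynomials in P, so the discrete Fourier transform turns determinants into products over
the q-th roots of unity ζ. Adding all columns to one of them extracts the factor (1 − ζ)(1 − ζ⁻¹)
and leaves G(ζ) for an integral polynomial G. These factors with ζ ≠ 1 multiply to q². Combined with
the matrix tree theorem this gives κ_n S = q N, where κ_n counts the spanning trees of the layer, S
is the sum of the degrees and N is the product of all G(ζ).

Modulo p the matrix P is unipotent, so N is prime to p as soon as G(1) is. Moreover G(1) = S c with
c = det(2Δ + e_r e_rᵀ). Hence, if S and c are prime to p, then ord_p κ_n = n for every n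
(`DiMultigraph.numSpanningTrees_layer`). In particular κ_n ≠ 0, so all layers are connected, n₀ = 0,
and the invariants are 0 and 1.

For a volcano, counting vertices by level gives S = 2k l^d (`IsVolcanoMatrix.sum_deg`). If p divided
c, there would be a nonzero function mod p that is harmonic on X and vanishes at r. But a harmonic
function is constant on the trees hanging off the crater and is an arithmetic progression of period
k along the crater, hence constant because p does not divide k
(`IsVolcanoMatrix.const_of_harmonic`). -/

/-! ### Determinant identities: Cauchy–Binet and rank one perturbations -/

open Matrix in
/-- An averaged form of the Cauchy–Binet formula. -/
theorem Matrix.factorial_mul_det_mul_transpose {n m R : Type*} [Fintype n] [DecidableEq n]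
    [Fintype m] [CommRing R] (B : Matrix n m R) :
    ((Fintype.card n).factorial : R) * (B * Bᵀ).det =
      ∑ f : n → m, (B.submatrix id f).det ^ 2 := by
  classical
  -- Multilinear expansion: the i-th row of the Gram matrix is a combination of rows indexed by the
  -- value f i.
  have h1 : (B * Bᵀ).det = ∑ f : n → m, (∏ i, B i (f i)) * (B.submatrix id f).det := by
    have e : B * Bᵀ = of fun i j => ∑ e, B j e * B i e := by
      ext i j
      simp [mul_apply, mul_comm]
    rw [e, det_apply]
    simp only [of_apply, Finset.prod_univ_sum, Fintype.piFinset_univ, det_apply,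
      Finset.smul_sum, Finset.mul_sum, submatrix_apply, id]
    rw [Finset.sum_comm]
    refine Finset.sum_congr rfl fun f _ => Finset.sum_congr rfl fun σ _ => ?_
    rw [Finset.prod_mul_distrib, mul_smul_comm]
  -- Expand one of the two factors over permutations σ; its sign is absorbed by permuting the
  -- columns of the other. Reindexing f by σ then gives the sum of `h1` once for every σ, whence the
  -- factorial.
  have h2 : ∑ f : n → m, (B.submatrix id f).det ^ 2 =
      ∑ σ : Equiv.Perm n, ∑ f : n → m, (∏ i, B i (f i)) * (B.submatrix id f).det := by
    have e : ∀ f : n → m, (B.submatrix id f).det ^ 2 = ∑ σ : Equiv.Perm n,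
        (∏ i, B i ((f ∘ σ) i)) * (B.submatrix id (f ∘ σ)).det := by
      intro f
      rw [sq]
      nth_rewrite 1 [← det_transpose]
      rw [det_apply', Finset.sum_mul]
      refine Finset.sum_congr rfl fun σ _ => ?_
      have : B.submatrix id (f ∘ σ) = (B.submatrix id f).submatrix id σ := rfl
      rw [this, det_permute']
      simp only [transpose_apply, submatrix_apply, id, Function.comp]
      ring
    rw [Finset.sum_congr rfl fun f _ => e f, Finset.sum_comm]
    refine Finset.sum_congr rfl fun σ _ => ?_
    exact Fintype.sum_equiv (Equiv.arrowCongr σ.symm (Equiv.refl m)) _ _ fun f => rfl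
  rw [h2, ← h1, Finset.sum_const, Finset.card_univ, Fintype.card_perm, nsmul_eq_mul]

open Matrix in
/-- A rank one perturbation of a matrix with vanishing row and column sums. -/
theorem Matrix.det_add_vecMulVec_of_sum_eq_zero {n R : Type*} [Fintype n] [DecidableEq n]
    [CommRing R] (L : Matrix n n R) (hrow : L *ᵥ 1 = 0) (hcol : 1 ᵥ* L = 0) (i : n)
    (u w : n → R) :
    (L + vecMulVec u w).det =
      (∑ j, u j) * (∑ j, w j) * (L + vecMulVec (Pi.single i 1) (Pi.single i 1)).det := by
  have key : ∀ (M : Matrix n n R) (_ : M *ᵥ 1 = 0) (x w : n → R),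
      (M + vecMulVec x w).det = (∑ j, w j) * (M + vecMulVec x (Pi.single i 1)).det := by
    intro M hM x w
    -- The factorization uses M1 = 0 and (x e_iᵀ)1 = x. The second factor is a rank one perturbation
    -- of the identity, of determinant 1 + (w − e_i)·1 = ∑ w.
    have e : M + vecMulVec x w = (M + vecMulVec x (Pi.single i 1)) *
        (1 + vecMulVec 1 (w - Pi.single i 1)) := by
      rw [mul_add, mul_one, mul_vecMulVec, add_mulVec, hM, vecMulVec_mulVec, zero_add]
      have : MulOpposite.op (Pi.single i (1 : R) ⬝ᵥ (1 : n → R)) • x = x := by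
        ext; simp
      rw [this, vecMulVec_sub]
      abel
    rw [e, det_mul, mul_comm]
    congr 1
    have := det_one_add_replicateCol_mul_replicateRow (ι := Unit) (1 : n → R) (w - Pi.single i 1)
    rw [← vecMulVec_eq] at this
    rw [this]
    simp [dotProduct]
  have h1 := key L hrow u w
  have h2 := key Lᵀ (by rw [mulVec_transpose, hcol]) (Pi.single i 1) u
  rw [← det_transpose, ← det_transpose (Lᵀ + vecMulVec (Pi.single i 1) (Pi.single i 1))] at h2
  simp only [transpose_add, transpose_transpose, transpose_vecMulVec] at h2
  rw [h1, h2]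
  ring

/-! ### The matrix tree theorem -/

theorem Graph.Reach.symm {V E : Type*} {G : Graph V E} {x y : V} (h : G.Reach x y) :
    G.Reach y x :=
  (inferInstance : Std.Symm (Relation.ReflTransGen G.Adj)).symm _ _ h

/-- The incidence matrix of a directed multigraph. -/
def DiMultigraph.incMat {V E : Type*} [DecidableEq V] (D : DiMultigraph V E) : Matrix V E ℤ :=
  Matrix.of fun v e => (if v = D.src e then 1 else 0) - (if v = D.tgt e then 1 else 0)

/-- The incidence matrix with an additional column marking a root. -/
def DiMultigraph.rootedIncMat {V E : Type*} [DecidableEq V] (D : DiMultigraph V E) (r : V) :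
    Matrix V (Option E) ℤ :=
  Matrix.of fun v e => e.elim (if v = r then 1 else 0) (D.incMat v)

open Matrix in
theorem DiMultigraph.rootedIncMat_mul_transpose {V E : Type*} [DecidableEq V] [Fintype E]
    (D : DiMultigraph V E) (r : V) :
    D.rootedIncMat r * (D.rootedIncMat r)ᵀ =
      D.incMat * D.incMatᵀ + vecMulVec (Pi.single r 1) (Pi.single r 1) := by
  ext u v
  simp [mul_apply, rootedIncMat, Fintype.sum_option, vecMulVec_apply, Pi.single_apply, add_comm]

/-- The spanning subgraph of `D` with the edges picked by `f` is connected and `f` picks the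
root. -/
def DiMultigraph.IsConnChoice {V E ι : Type*} (D : DiMultigraph V E) (f : ι → Option E) : Prop :=
  none ∈ Set.range f ∧ (D.toGraph.restrict {e | some e ∈ Set.range f}).IsConn

-- The columns generate ℤ^V: the root column is e_r, and along a selected edge one basis vector is
-- obtained from the other by adding or subtracting a column. A surjective square integral matrix is
-- invertible.
open Matrix in
theorem DiMultigraph.isUnit_det_of_isConnChoice {V E : Type*} [Fintype V] [DecidableEq V]
    (D : DiMultigraph V E) (r : V) (f : V → Option E) (hf : D.IsConnChoice f) :
    IsUnit ((D.rootedIncMat r).submatrix id f).det := by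
  set M := (D.rootedIncMat r).submatrix id f with hM
  obtain ⟨⟨i₀, hi₀⟩, hconn⟩ := hf
  have hcol : ∀ i, M *ᵥ Pi.single i 1 = fun v => D.rootedIncMat r v (f i) := by
    intro i; ext v; simp [hM]
  have hbase : ∃ w, M *ᵥ w = Pi.single r 1 := by
    refine ⟨Pi.single i₀ 1, ?_⟩
    rw [hcol, hi₀]; ext v; simp [rootedIncMat, Pi.single_apply]
  have hall : ∀ y, ∃ w, M *ᵥ w = Pi.single y 1 := by
    intro y
    have hr := hconn.2 r (Set.mem_univ _) y (Set.mem_univ _)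
    induction hr with
    | refl => exact hbase
    | @tail b c _ hbc ih =>
      obtain ⟨w, hw⟩ := ih
      obtain ⟨e, ⟨j, hj⟩, he⟩ := hbc
      have hcj : M *ᵥ Pi.single j 1 = Pi.single (D.src e) 1 - Pi.single (D.tgt e) 1 := by
        rw [hcol, hj]; ext v; simp [rootedIncMat, incMat, Pi.single_apply]
      rcases he with ⟨h1, h2⟩ | ⟨h1, h2⟩
      · exact ⟨w - Pi.single j 1, by rw [mulVec_sub, hw, hcj, h1, h2]; abel⟩
      · exact ⟨w + Pi.single j 1, by rw [mulVec_add, hw, hcj, h1, h2]; abel⟩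
  rw [← isUnit_iff_isUnit_det, ← mulVec_surjective_iff_isUnit]
  intro y
  choose g hg using hall
  refine ⟨∑ v, y v • g v, ?_⟩
  rw [mulVec_sum]
  simp only [mulVec_smul, hg]
  ext v
  simp [Finset.sum_apply, Pi.single_apply]

-- A nonzero left kernel vector exists: the all-ones vector if the root column is missing, otherwise
-- the indicator of the vertices not reachable from r.
open Matrix in
theorem DiMultigraph.det_eq_zero_of_not_isConnChoice {V E : Type*} [Fintype V] [DecidableEq V]
    (D : DiMultigraph V E) (r : V) (f : V → Option E) (hf : ¬ D.IsConnChoice f) :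
    ((D.rootedIncMat r).submatrix id f).det = 0 := by
  classical
  rw [← exists_vecMul_eq_zero_iff]
  by_cases h0 : none ∈ Set.range f
  · have hnc : ¬ (D.toGraph.restrict {e | some e ∈ Set.range f}).IsConn := fun h => hf ⟨h0, h⟩
    set H := D.toGraph.restrict {e | some e ∈ Set.range f} with hH
    have : ∃ y, ¬ H.Reach r y := by
      by_contra hcon
      push Not at hcon
      refine hnc ⟨⟨r, Set.mem_univ _⟩, fun x _ y _ => ?_⟩
      have hsymm : ∀ {a b}, H.Reach a b → H.Reach b a := fun h => h.symm
      exact (hsymm (hcon x)).trans (hcon y)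
    obtain ⟨y, hy⟩ := this
    refine ⟨fun v => if H.Reach r v then 0 else 1, fun h => by simpa [hy] using congrFun h y, ?_⟩
    ext j
    simp only [vecMul, dotProduct, submatrix_apply, id, Pi.zero_apply]
    rcases hj : f j with _ | e
    · have : H.Reach r r := Relation.ReflTransGen.refl
      simp [rootedIncMat, this]
    · have hadj : H.Adj (D.src e) (D.tgt e) := ⟨e, ⟨j, hj⟩, Or.inl ⟨rfl, rfl⟩⟩
      have : H.Reach r (D.src e) ↔ H.Reach r (D.tgt e) :=
        ⟨fun h => h.tail hadj, fun h => h.tail hadj.symm⟩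
      simp [rootedIncMat, incMat, mul_sub, Finset.sum_sub_distrib, this]
  · refine ⟨1, fun h => by simpa using congrFun h r, ?_⟩
    ext j
    simp only [vecMul, dotProduct, submatrix_apply, id, Pi.zero_apply]
    rcases hj : f j with _ | e
    · exact absurd ⟨j, hj⟩ h0
    · simp [rootedIncMat, incMat, Finset.sum_sub_distrib]

/-- A repeated column would make the determinant vanish, but it is a unit. -/
theorem DiMultigraph.IsConnChoice.injective {V E : Type*} [Finite V] {D : DiMultigraph V E}
    {f : V → Option E} (hf : D.IsConnChoice f) : Function.Injective f := by
  classical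
  have := Fintype.ofFinite V
  obtain ⟨⟨r, hr⟩, -⟩ := id hf
  intro i j hij
  by_contra hne
  have h1 := D.isUnit_det_of_isConnChoice r f hf
  rw [Matrix.det_zero_of_column_eq hne fun k => by simp [hij]] at h1
  simp at h1

theorem Graph.Reach.mono {V E : Type*} {G H : Graph V E} (h : ∀ a b, G.Adj a b → H.Adj a b)
    {x y : V} (hxy : G.Reach x y) : H.Reach x y := by
  induction hxy with
  | refl => exact Relation.ReflTransGen.refl
  | tail _ hbc ih => exact ih.tail (h _ _ hbc)

/-- The edge e closes a simple path from x to y that avoids it. If x = y the path is trivial and the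
cycle is the loop e. -/
theorem Graph.exists_isCycleGraph_of_reach {V E : Type*} {G : Graph V E} {e : E} {x y : V}
    (he : G.IsLink e x y) (h : (G.restrict {e}ᶜ).Reach x y) :
    ∃ (H : Graph V E) (k : ℕ), H ≤ G ∧ H.IsCycleGraph k := by
  classical
  set G' := G.restrict {e}ᶜ with hG'
  have hadj : ∀ a b, (SimpleGraph.fromRel G'.Adj).Adj a b → ∃ f, f ≠ e ∧ G.IsLink f a b := by
    rintro a b ⟨-, ⟨f, hf⟩ | ⟨f, hf⟩⟩
    · exact ⟨f, hf.1, hf.2⟩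
    · exact ⟨f, hf.1, hf.2.symm⟩
  have hreach : (SimpleGraph.fromRel G'.Adj).Reachable x y := by
    clear he
    induction h with
    | refl => exact SimpleGraph.Reachable.refl _
    | @tail b c _ hbc ih =>
      by_cases hbc' : b = c
      · exact hbc' ▸ ih
      · exact ih.trans (SimpleGraph.Adj.reachable ⟨hbc', Or.inl hbc⟩)
  obtain ⟨q, hq⟩ := hreach.exists_isPath
  set n := q.length with hn
  have hstep : ∀ i : Fin n, ∃ f, f ≠ e ∧ G.IsLink f (q.getVert i) (q.getVert (i + 1)) :=
    fun i => hadj _ _ (q.adj_getVert_succ i.2)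
  choose g hge hg using hstep
  let v : Fin (n + 1) → V := fun i => q.getVert i
  let ed : Fin (n + 1) → E := Fin.lastCases e g
  have hv : Function.Injective v := fun i j hij =>
    Fin.ext (hq.getVert_injOn (by simp; omega) (by simp; omega) hij)
  have hlast : v (Fin.last n) = y := by simp [v, hn]
  have hlink : ∀ i : Fin (n + 1), G.IsLink (ed i) (v i) (v (i + 1)) := by
    intro i
    induction i using Fin.lastCases with
    | last =>
      have h0 : v 0 = x := by simp [v]
      simpa [ed, hlast, h0] using he.symm
    | cast i =>
      have h1 : i.castSucc + 1 = i.succ := by simp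
      rw [h1]
      simpa [ed, v] using hg i
  have hed : Function.Injective ed := by
    intro i j hij
    induction i using Fin.lastCases with
    | last =>
      induction j using Fin.lastCases with
      | last => rfl
      | cast j => exact absurd (by simpa [ed] using hij.symm) (hge j)
    | cast i =>
      induction j using Fin.lastCases with
      | last => exact absurd (by simpa [ed] using hij) (hge i)
      | cast j =>
        have hij' : g i = g j := by simpa [ed] using hij
        have inj : ∀ {a b : ℕ}, a ≤ n → b ≤ n → q.getVert a = q.getVert b → a = b :=
          fun ha hb hab => hq.getVert_injOn (by simpa using ha) (by simpa using hb) hab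
        rcases (hg i).eq_and_eq_or_eq_and_eq (hij' ▸ hg j) with ⟨h1, -⟩ | ⟨h1, h2⟩
        · exact Fin.ext (inj i.2.le j.2.le h1)
        -- An edge of the path traversed in both directions would force i = j + 1 and j = i + 1.
        · have := inj (by omega) (by omega) h1
          have := inj (by omega) (by omega) h2
          omega
  refine ⟨⟨Set.range v, fun f a b => f ∈ Set.range ed ∧ G.IsLink f a b, Set.range ed,
    ?_, ?_, ?_, ?_⟩, n + 1, ⟨?_, ?_⟩, by omega, v, ed, hv, rfl, hed, rfl, fun i => ⟨⟨i, rfl⟩, hlink i⟩⟩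
  · exact fun f _ => ⟨fun a b h => ⟨h.1, h.2.symm⟩⟩
  · exact fun f a b c d h h' => h.2.left_eq_or_eq h'.2
  · rintro f
    constructor
    · rintro ⟨i, rfl⟩; exact ⟨_, _, ⟨i, rfl⟩, hlink i⟩
    · rintro ⟨_, _, h⟩; exact h.1
  · rintro f a b ⟨⟨i, rfl⟩, h⟩
    rcases h.left_eq_or_eq (hlink i) with rfl | rfl <;> exact ⟨_, rfl⟩
  · rintro _ ⟨i, rfl⟩; exact (hlink i).left_mem
  · exact fun f a b h => h.2

theorem Graph.IsConn.restrict_compl_singleton {V E : Type*} {G : Graph V E} (hG : G.IsConn)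
    {e : E} {x y : V} (he : G.IsLink e x y) (h : (G.restrict {e}ᶜ).Reach x y) :
    (G.restrict {e}ᶜ).IsConn := by
  refine ⟨hG.1, fun a ha b hb => ?_⟩
  have := hG.2 a ha b hb
  induction this with
  | refl => exact Relation.ReflTransGen.refl
  | @tail b c _ hbc ih =>
    refine (ih hbc.left_mem).trans ?_
    obtain ⟨f, hf⟩ := hbc
    by_cases hfe : f = e
    · subst hfe
      rcases he.eq_and_eq_or_eq_and_eq hf with ⟨rfl, rfl⟩ | ⟨rfl, rfl⟩
      · exact h
      · exact h.symm
    · exact Relation.ReflTransGen.single ⟨f, hfe, hf⟩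

theorem Graph.IsConn.exists_restrict_compl_singleton {V E : Type*} {G H : Graph V E}
    (hG : G.IsConn) (hH : H ≤ G) {k : ℕ} (hk : H.IsCycleGraph k) :
    ∃ e ∈ G.edgeSet, (G.restrict {e}ᶜ).IsConn := by
  obtain ⟨hk1, v, e, -, -, he, -, hl⟩ := hk
  have hl' : ∀ i, G.IsLink (e i) (v i) (v (i + 1)) := fun i => (hl i).mono hH
  refine ⟨e 0, (hl' 0).edge_mem, hG.restrict_compl_singleton (hl' 0) ?_⟩
  -- Going round the cycle from v 1 through v 2, …, up to v k = v 0 never uses the edge e 0.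
  have key : ∀ j : ℕ, j < k → (G.restrict {e 0}ᶜ).Reach (v 1) (v ((1 + j : ℕ) : ZMod k)) := by
    intro j
    induction j with
    | zero => intro _; rw [Nat.add_zero, Nat.cast_one]; exact Relation.ReflTransGen.refl
    | succ j ih =>
      intro hj
      refine (ih (by omega)).tail ⟨e ((1 + j : ℕ) : ZMod k), fun h => ?_, ?_⟩
      · have := he h
        rw [ZMod.natCast_eq_zero_iff] at this
        have := Nat.le_of_dvd (by omega) this
        omega
      · have := hl' ((1 + j : ℕ) : ZMod k)
        rwa [show (((1 + (j + 1) : ℕ)) : ZMod k) = ((1 + j : ℕ) : ZMod k) + 1 by push_cast; ring]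
  have := key (k - 1) (by omega)
  rw [show 1 + (k - 1) = k by omega, ZMod.natCast_self] at this
  simpa using this.symm

/-- If there were a cycle, one of its edges could be dropped without losing connectedness. Letting
the slot of that edge pick the root instead gives a connected choice that takes the value `none`
twice, against injectivity. -/
theorem DiMultigraph.IsConnChoice.isTreeGraph {V E : Type*} [Finite V] {D : DiMultigraph V E}
    {f : V → Option E} (hf : D.IsConnChoice f) :
    (D.toGraph.restrict {e | some e ∈ Set.range f}).IsTreeGraph := by
  classical
  refine ⟨hf.2, fun H k hH hk => ?_⟩
  obtain ⟨e, he, hconn⟩ := hf.2.exists_restrict_compl_singleton hH hk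
  obtain ⟨i, hi⟩ : some e ∈ Set.range f := he.2
  obtain ⟨i₀, hi₀⟩ := hf.1
  have hne : i ≠ i₀ := by rintro rfl; simp [hi₀] at hi
  have hinj := hf.injective
  have hrange : {e' | some e' ∈ Set.range (Function.update f i none)} =
      {e' | some e' ∈ Set.range f} ∩ {e}ᶜ := by
    ext e'
    simp only [Set.mem_range, Set.mem_ofPred_eq, Set.mem_inter_iff, Set.mem_compl_iff,
      Set.mem_singleton_iff]
    constructor
    · rintro ⟨j, hj⟩
      rcases eq_or_ne j i with rfl | hji
      · simp at hj
      · rw [Function.update_of_ne hji] at hj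
        refine ⟨⟨j, hj⟩, ?_⟩
        rintro rfl
        exact hji (hinj (hj.trans hi.symm))
    · rintro ⟨⟨j, hj⟩, hne'⟩
      have hji : j ≠ i := by
        rintro rfl
        exact hne' (Option.some.inj (hj.symm.trans hi))
      exact ⟨j, by rw [Function.update_of_ne hji, hj]⟩
  have hf' : D.IsConnChoice (Function.update f i none) := by
    refine ⟨⟨i, by simp⟩, ?_⟩
    rw [hrange, ← Graph.restrict_restrict]
    exact hconn
  exact hne (hf'.injective (by simp [Function.update_of_ne hne.symm, hi₀]))

/-- In a connected graph every vertex but the root has an edge to a vertex closer to the root. -/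
theorem Graph.IsConn.exists_parent {V E : Type*} {G : Graph V E} (hG : G.IsConn) (r : V)
    (hr : r ∈ G.vertexSet) : ∃ δ : V → ℕ, ∀ v ∈ G.vertexSet, v ≠ r →
      ∃ e u, G.IsLink e v u ∧ δ u < δ v := by
  classical
  let S := SimpleGraph.fromRel G.Adj
  have hadj : ∀ a b, S.Adj a b → G.Adj a b := by
    rintro a b ⟨-, h | h⟩
    exacts [h, h.symm]
  refine ⟨fun v => S.dist v r, fun v hv hne => ?_⟩
  have hreach : S.Reachable v r := by
    have := hG.2 v hv r hr
    clear hne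
    induction this with
    | refl => exact SimpleGraph.Reachable.refl _
    | @tail b c _ hbc ih =>
      by_cases hbc' : b = c
      · exact hbc' ▸ ih hbc.left_mem
      · exact (ih hbc.left_mem).trans (SimpleGraph.Adj.reachable ⟨hbc', Or.inl hbc⟩)
  obtain ⟨q, hq⟩ := hreach.exists_walk_length_eq_dist
  cases q with
  | nil => exact absurd rfl hne
  | cons h q' =>
    obtain ⟨e, he⟩ := hadj _ _ h
    refine ⟨e, _, he, ?_⟩
    have := SimpleGraph.dist_le q'
    simp only [SimpleGraph.Walk.length_cons] at hq
    change S.dist _ r < S.dist v r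
    omega

/-- The root picks `none`, and every other vertex picks an edge to a vertex closer to the root. -/
theorem DiMultigraph.exists_isConnChoice {V E : Type*} {D : DiMultigraph V E} {T : Graph V E}
    (hT : T.IsSpanningSubgraph D.toGraph) (hconn : T.IsConn) :
    ∃ f : V → Option E, D.IsConnChoice f ∧ ∀ e, some e ∈ Set.range f → e ∈ T.edgeSet := by
  classical
  have hV : ∀ v, v ∈ T.vertexSet := fun v => hT.vertexSet_eq ▸ Set.mem_univ v
  obtain ⟨r, hr⟩ := hconn.1
  obtain ⟨δ, hδ⟩ := hconn.exists_parent r hr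
  have : ∀ v, ∃ o : Option E, (v = r → o = none) ∧
      (v ≠ r → ∃ e u, o = some e ∧ T.IsLink e v u ∧ δ u < δ v) := by
    intro v
    by_cases h : v = r
    · exact ⟨none, fun _ => rfl, fun h' => absurd h h'⟩
    · obtain ⟨e, u, he⟩ := hδ v (hV v) h
      exact ⟨some e, fun h' => absurd h' h, fun _ => ⟨e, u, rfl, he⟩⟩
  choose f hf0 hf1 using this
  refine ⟨f, ⟨⟨r, hf0 r rfl⟩, ⟨r, Set.mem_univ r⟩, ?_⟩, ?_⟩
  · have key : ∀ n v, δ v ≤ n →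
        (D.toGraph.restrict {e | some e ∈ Set.range f}).Reach v r := by
      intro n
      induction n with
      | zero =>
        intro v hv
        by_cases h : v = r
        · exact h ▸ Relation.ReflTransGen.refl
        · obtain ⟨_, _, _, _, h⟩ := hf1 v h
          omega
      | succ n ih =>
        intro v hv
        by_cases h : v = r
        · exact h ▸ Relation.ReflTransGen.refl
        · obtain ⟨e, u, h1, h2, h3⟩ := hf1 v h
          exact Relation.ReflTransGen.head ⟨e, ⟨v, h1⟩, h2.mono hT.le⟩ (ih u (by omega))
    exact fun x _ y _ => (key _ x le_rfl).trans (key _ y le_rfl).symm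
  · rintro e ⟨v, hv⟩
    by_cases h : v = r
    · simp [hf0 v h] at hv
    · obtain ⟨e', u, h1, h2, -⟩ := hf1 v h
      rw [hv] at h1
      exact Option.some.inj h1 ▸ h2.edge_mem

/-- Trees are minimal among connected spanning subgraphs: an omitted edge, closed up by a path in
the rest, would lie on a cycle. -/
theorem Graph.IsTreeGraph.eq_of_isConn_restrict {V E : Type*} {T : Graph V E}
    (hT : T.IsTreeGraph) {F : Set E} (hF : (T.restrict F).IsConn) : T.edgeSet ⊆ F := by
  intro e he
  by_contra heF
  obtain ⟨x, y, hxy⟩ := T.exists_isLink_of_mem_edgeSet he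
  have hr : (T.restrict {e}ᶜ).Reach x y := by
    refine Graph.Reach.mono ?_ (hF.2 x hxy.left_mem y hxy.right_mem)
    rintro a b ⟨f, hf⟩
    exact ⟨f, fun h => heF (h ▸ hf.1), hf.2⟩
  obtain ⟨H, k, hH, hk⟩ := Graph.exists_isCycleGraph_of_reach hxy hr
  exact hT.2 H k hH hk

theorem DiMultigraph.exists_isConnChoice_restrict_eq {V E : Type*} {D : DiMultigraph V E}
    {T : Graph V E} (hT : T.IsSpanningSubgraph D.toGraph) (htree : T.IsTreeGraph) :
    ∃ f : V → Option E, D.IsConnChoice f ∧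
      D.toGraph.restrict {e | some e ∈ Set.range f} = T := by
  obtain ⟨f, hf, hfT⟩ := exists_isConnChoice hT htree.1
  set F := {e | some e ∈ Set.range f} with hF
  have hsub : D.toGraph.restrict F ≤ T := by
    refine ⟨hT.vertexSet_eq.ge, fun e x y h => ?_⟩
    exact (hT.le.isLink_iff (hfT e h.1)).2 h.2
  have hEF : T.edgeSet ⊆ F := by
    refine htree.eq_of_isConn_restrict ?_
    have : T.restrict F = D.toGraph.restrict F := by
      refine Graph.ext hT.vertexSet_eq fun e x y => ⟨fun h => ⟨h.1, h.2.mono hT.le⟩,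
        fun h => ⟨h.1, h.mono hsub⟩⟩
    rw [this]
    exact hf.2
  refine ⟨f, hf, le_antisymm hsub ⟨fun _ _ => Set.mem_univ _, fun e x y h => ?_⟩⟩
  exact ⟨hEF h.edge_mem, h.mono hT.le⟩

/-- The connected choices with a given spanning tree are the bijections from V onto its edges
together with `none`, so the permutations of V act on them simply transitively. -/
theorem DiMultigraph.card_isConnChoice {V E : Type*} [Fintype V] (D : DiMultigraph V E) :
    Nat.card {f : V → Option E // D.IsConnChoice f} =
      D.toGraph.numSpanningTrees * (Fintype.card V).factorial := by
  classical
  let Tr := {T : Graph V E | T.IsSpanningSubgraph D.toGraph ∧ T.IsTreeGraph}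
  have hex : ∀ T : Tr, ∃ f : V → Option E, D.IsConnChoice f ∧
      D.toGraph.restrict {e | some e ∈ Set.range f} = T :=
    fun T => exists_isConnChoice_restrict_eq T.2.1 T.2.2
  choose g hg hgT using hex
  have hcomp : ∀ (f : V → Option E) (σ : Equiv.Perm V), Set.range (f ∘ σ) = Set.range f :=
    fun f σ => σ.surjective.range_comp f
  let F : Tr × Equiv.Perm V → {f : V → Option E // D.IsConnChoice f} := fun x =>
    ⟨g x.1 ∘ x.2, by
      have := hg x.1
      unfold IsConnChoice at this ⊢
      rwa [hcomp]⟩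
  have hF : Function.Bijective F := by
    constructor
    · rintro ⟨T, σ⟩ ⟨T', σ'⟩ h
      have h' : g T ∘ σ = g T' ∘ σ' := congrArg Subtype.val h
      have hTT : T = T' := by
        apply Subtype.ext
        rw [← hgT T, ← hgT T', ← hcomp (g T) σ, h', hcomp]
      subst hTT
      refine Prod.ext rfl (Equiv.ext fun v => (hg T).injective (congrFun h' v))
    · rintro ⟨f, hf⟩
      let T : Tr := ⟨D.toGraph.restrict {e | some e ∈ Set.range f},
        ⟨Graph.restrict_le, rfl⟩, hf.isTreeGraph⟩
      have hrange : Set.range f = Set.range (g T) := by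
        have hE : ({e | some e ∈ Set.range (g T)} : Set E) = {e | some e ∈ Set.range f} := by
          have := congrArg Graph.edgeSet (hgT T)
          simpa [T, DiMultigraph.toGraph] using this
        ext o
        cases o with
        | none => exact ⟨fun _ => (hg T).1, fun _ => hf.1⟩
        | some e => exact (Set.ext_iff.1 hE e).symm
      let σ : Equiv.Perm V := (Equiv.ofInjective f hf.injective).trans
        ((Equiv.setCongr hrange).trans (Equiv.ofInjective (g T) (hg T).injective).symm)
      refine ⟨(T, σ), Subtype.ext (funext fun v => ?_)⟩
      change g T (σ v) = f v
      have := Equiv.apply_ofInjective_symm (hg T).injective ⟨f v, hrange ▸ ⟨v, rfl⟩⟩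
      exact this
  rw [← Nat.card_congr (Equiv.ofBijective F hF), Nat.card_prod, Nat.card_eq_fintype_card (α := Equiv.Perm V),
    Fintype.card_perm]
  rfl

open Matrix in
/-- Kirchhoff's matrix tree theorem. -/
theorem DiMultigraph.numSpanningTrees_eq_det {V E : Type*} [Fintype V] [DecidableEq V] [Fintype E]
    (D : DiMultigraph V E) (r : V) :
    (D.toGraph.numSpanningTrees : ℤ) =
      (D.incMat * D.incMatᵀ + vecMulVec (Pi.single r 1) (Pi.single r 1)).det := by
  classical
  have h := factorial_mul_det_mul_transpose (D.rootedIncMat r)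
  have h2 : ∀ f : V → Option E, ((D.rootedIncMat r).submatrix id f).det ^ 2 =
      if D.IsConnChoice f then 1 else 0 := by
    intro f
    split_ifs with hf
    · rcases Int.isUnit_iff.1 (D.isUnit_det_of_isConnChoice r f hf) with h | h <;> simp [h]
    · simp [D.det_eq_zero_of_not_isConnChoice r f hf]
  simp only [h2, Finset.sum_boole] at h
  have hc := D.card_isConnChoice
  rw [Nat.card_eq_fintype_card, Fintype.card_subtype] at hc
  rw [hc, D.rootedIncMat_mul_transpose, Nat.cast_mul, mul_comm] at h
  exact (mul_right_cancel₀ (by exact_mod_cast Nat.factorial_ne_zero _) h).symm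

theorem DiMultigraph.isConn_of_numSpanningTrees_ne_zero {V E : Type*} {D : DiMultigraph V E}
    (h : D.toGraph.numSpanningTrees ≠ 0) : D.toGraph.IsConn := by
  obtain ⟨T, hT, htree⟩ := Set.nonempty_of_ncard_ne_zero h
  obtain ⟨h1, h2⟩ := htree.1
  rw [hT.vertexSet_eq] at h1 h2
  exact ⟨h1, fun x hx y hy => Graph.Reach.mono (fun _ _ h => h.mono hT.le) (h2 x hx y hy)⟩

/-! ### Translation matrices on ℤ/q and their polynomials -/

/-- The matrix of the translation by `a` on functions on `ZMod q`. -/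
def ZMod.shiftMat (R : Type*) [CommRing R] {q : ℕ} (a : ZMod q) :
    Matrix (ZMod q) (ZMod q) R :=
  Matrix.of fun s t => if t = s + a then 1 else 0

namespace ZMod.shiftMat

open Matrix Polynomial

variable {R : Type*} [CommRing R] {q : ℕ} (a : ZMod q)

theorem zero_eq : ZMod.shiftMat R (0 : ZMod q) = 1 := by
  ext s t; simp [ZMod.shiftMat, one_apply, eq_comm]

theorem mul_eq [NeZero q] (b : ZMod q) :
    ZMod.shiftMat R a * ZMod.shiftMat R b = ZMod.shiftMat R (a + b) := by
  ext s t
  simp only [ZMod.shiftMat, mul_apply, of_apply, ite_mul, one_mul, zero_mul,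
    Finset.sum_ite_eq', Finset.mem_univ, if_true, add_assoc]

theorem pow_eq [NeZero q] (n : ℕ) : ZMod.shiftMat R a ^ n = ZMod.shiftMat R (n • a) := by
  induction n with
  | zero => simp [zero_eq]
  | succ n ih => rw [pow_succ, ih, mul_eq, succ_nsmul]

theorem pow_card [NeZero q] : ZMod.shiftMat R a ^ q = 1 := by
  rw [pow_eq, ← zero_eq]
  congr 1
  simp

/-- This expresses the inverse of the translation as a polynomial in it, so that no Laurent
polynomials are needed. -/
theorem pow_card_sub_one [NeZero q] : ZMod.shiftMat R a ^ (q - 1) = (ZMod.shiftMat R a)ᵀ := by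
  have hq : 1 ≤ q := NeZero.one_le
  rw [pow_eq]
  ext s t
  have : (q - 1) • a = -a := by
    rw [nsmul_eq_mul, Nat.cast_sub hq]; simp
  simp only [ZMod.shiftMat, this, of_apply, transpose_apply]
  have : t = s + -a ↔ s = t + a := by
    rw [eq_add_neg_iff_add_eq, eq_comm]
  simp only [this]

theorem map_eq {S : Type*} [CommRing S] (φ : R →+* S) :
    (ZMod.shiftMat R a).map φ = ZMod.shiftMat S a := by
  ext s t; simp [ZMod.shiftMat, apply_ite φ]

theorem map_aeval [NeZero q] {S : Type*} [CommRing S] (φ : R →+* S) (f : R[X]) :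
    (aeval (ZMod.shiftMat R a) f).map φ = aeval (ZMod.shiftMat S a) (f.map φ) := by
  have : ((φ.mapMatrix : Matrix (ZMod q) (ZMod q) R →+* _)) (aeval (ZMod.shiftMat R a) f) =
      aeval (ZMod.shiftMat S a) (f.map φ) := by
    rw [aeval_def, hom_eval₂, aeval_def, eval₂_map]
    congr 1
    · ext r i j
      simp [algebraMap_matrix_apply, apply_ite φ]
    · exact map_eq a φ
  exact this

/-- A polynomial in a translation is diagonalized by the discrete Fourier transform. -/
theorem det_aeval [NeZero q] (f : ℂ[X]) : (aeval (ZMod.shiftMat ℂ a) f).det =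
    ∏ i : ZMod q, f.eval (ZMod.stdAddChar (i * a)) := by
  set U : Matrix (ZMod q) (ZMod q) ℂ := of fun s i => ZMod.stdAddChar (s * i) with hU
  set U' : Matrix (ZMod q) (ZMod q) ℂ := of fun s i => ZMod.stdAddChar (-(s * i)) with hU'
  set Δ : Matrix (ZMod q) (ZMod q) ℂ := diagonal fun i => ZMod.stdAddChar (i * a) with hΔ
  have h1 : ZMod.shiftMat ℂ a * U = U * Δ := by
    ext s i
    rw [hΔ, mul_diagonal]
    simp only [ZMod.shiftMat, hU, mul_apply, of_apply, ite_mul, one_mul,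
      zero_mul, Finset.sum_ite_eq', Finset.mem_univ, if_true, add_mul,
      AddChar.map_add_eq_mul, mul_comm i a]
  have h2 : U' * U = (q : ℂ) • 1 := by
    ext i j
    have h := AddChar.sum_mulShift (j - i) (ZMod.isPrimitive_stdAddChar q)
    rw [ZMod.card] at h
    simp only [hU, hU', mul_apply, of_apply, Matrix.smul_apply, one_apply, smul_eq_mul,
      ← AddChar.map_add_eq_mul]
    have e : ∀ x : ZMod q, -(i * x) + x * j = x * (j - i) := fun x => by ring
    simp only [e, h, sub_eq_zero, eq_comm (a := j)]
    split_ifs <;> simp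
  -- The Fourier matrix is invertible because U' U = q.
  have hdet : U.det ≠ 0 := by
    intro h0
    have := congrArg det h2
    rw [det_mul, h0, mul_zero, det_smul, det_one, mul_one] at this
    exact pow_ne_zero _ (by exact_mod_cast NeZero.ne q) this.symm
  have h3 : ∀ g : ℂ[X], aeval (ZMod.shiftMat ℂ a) g * U = U * aeval Δ g := by
    intro g
    induction g using Polynomial.induction_on' with
    | add p q hp hq => simp only [map_add, add_mul, mul_add, hp, hq]
    | monomial n c =>
      have hn : ZMod.shiftMat ℂ a ^ n * U = U * Δ ^ n := by
        induction n with
        | zero => simp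
        | succ n ih => rw [pow_succ', mul_assoc, ih, ← mul_assoc, h1, mul_assoc, ← pow_succ']
      simp only [aeval_monomial, Algebra.algebraMap_eq_smul_one, smul_mul_assoc, one_mul, mul_smul_comm, hn]
  have h4 : aeval Δ f = diagonal fun i => f.eval (ZMod.stdAddChar (i * a)) := by
    have := (aeval_algHom_apply (diagonalAlgHom ℂ) (fun i : ZMod q => (ZMod.stdAddChar (i * a) : ℂ)) f)
    rw [hΔ]
    refine this.trans ?_
    simp only [diagonalAlgHom_apply]
    congr 1
    ext i
    simp
  have := congrArg det (h3 f)
  rw [det_mul, det_mul, mul_comm, h4, det_diagonal] at this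
  exact mul_left_cancel₀ hdet this

/-- If `f(1)` is prime to `p`, so is the resultant of `f` and `X^(p^m) - 1`. -/
theorem not_dvd_det_aeval {p : ℕ} [Fact p.Prime] {m : ℕ} (a : ZMod (p ^ m)) (f : ℤ[X])
    (hf : ¬ (p : ℤ) ∣ f.eval 1) : ¬ (p : ℤ) ∣ (aeval (ZMod.shiftMat ℤ a) f).det := by
  rw [← ZMod.intCast_zmod_eq_zero_iff_dvd] at hf ⊢
  set φ := Int.castRingHom (ZMod p) with hφ
  have e : ((aeval (ZMod.shiftMat ℤ a) f).det : ZMod p) =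
      (aeval (ZMod.shiftMat (ZMod p) a) (f.map φ)).det := by
    rw [← map_aeval]
    exact φ.map_det _
  rw [e]
  set P := ZMod.shiftMat (ZMod p) a with hP
  set g := f.map φ with hg
  have hg1 : g.eval 1 ≠ 0 := by
    rw [hg, eval_one_map]
    exact hf
  obtain ⟨h, hh⟩ := X_sub_C_dvd_sub_C_eval (a := (1 : ZMod p)) (p := g)
  -- In characteristic p, (P − 1)^(p^m) = P^(p^m) − 1 = 0. Hence g(P) is the unit g(1) plus a
  -- commuting nilpotent.
  have hnil : IsNilpotent (P - 1) := by
    refine ⟨p ^ m, ?_⟩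
    have : CharP (Matrix (ZMod (p ^ m)) (ZMod (p ^ m)) (ZMod p)) p := inferInstance
    rw [sub_pow_char_pow_of_commute _ _ (Commute.one_right P), one_pow, hP, pow_card, sub_self]
  have hval : aeval P g = aeval P h * (P - 1) + algebraMap _ _ (g.eval 1) := by
    have := congrArg (aeval P) (sub_eq_iff_eq_add.1 hh)
    rw [this]
    rw [mul_comm]
    simp
  have hcomm : Commute (aeval P h) (P - 1) := by
    have : P - 1 = aeval P (X - 1 : (ZMod p)[X]) := by simp
    rw [this]
    exact (Commute.all h (X - 1)).map (aeval P)
  have hu : IsUnit (aeval P g) := by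
    rw [hval]
    refine (hcomm.isNilpotent_mul_left hnil).isUnit_add_right_of_commute ?_
      (Algebra.commute_algebraMap_right _ _)
    exact (IsUnit.mk0 _ hg1).map _
  exact ((isUnit_iff_isUnit_det _).1 hu).ne_zero

/-- This is the value of (X^q − 1)/(X − 1) at X = 1. -/
theorem prod_one_sub_stdAddChar [NeZero q] :
    ∏ i ∈ Finset.univ.erase (0 : ZMod q), (1 - (ZMod.stdAddChar i : ℂ)) = q := by
  obtain ⟨n, rfl⟩ := Nat.exists_eq_succ_of_ne_zero (NeZero.ne q)
  have hprim : IsPrimitiveRoot (ZMod.stdAddChar (1 : ZMod (n + 1)) : ℂ) (n + 1) := by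
    refine IsPrimitiveRoot.mk_of_lt _ n.succ_pos ?_ fun l hl hln h => ?_
    · rw [← AddChar.map_nsmul_eq_pow]
      simp
    · rw [← AddChar.map_nsmul_eq_pow, ← AddChar.map_zero_eq_one (ZMod.stdAddChar (N := n + 1))] at h
      have := ZMod.injective_stdAddChar h
      rw [nsmul_one, ZMod.natCast_eq_zero_iff] at this
      exact absurd (Nat.le_of_dvd hl this) (by omega)
  rw [Nat.cast_succ, ← hprim.prod_one_sub_pow_eq_order]
  refine Finset.prod_nbij' (fun i => i.val - 1) (fun j => ((j + 1 : ℕ) : ZMod (n + 1)))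
    ?_ ?_ ?_ ?_ ?_
  · intro i hi
    have h1 := ZMod.val_lt i
    have h2 : i.val ≠ 0 := by simpa [ZMod.val_eq_zero] using hi
    simp only [Finset.mem_range]; omega
  · intro j hj
    rw [Finset.mem_range] at hj
    rw [Finset.mem_erase, Ne, ZMod.natCast_eq_zero_iff]
    exact ⟨fun h => by have := Nat.le_of_dvd j.succ_pos h; omega, Finset.mem_univ _⟩
  · intro i hi
    have h2 : i.val ≠ 0 := by simpa [ZMod.val_eq_zero] using hi
    simp [Nat.sub_add_cancel (Nat.pos_of_ne_zero h2)]
  · intro j hj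
    rw [Finset.mem_range] at hj
    change ZMod.val ((j + 1 : ℕ) : ZMod (n + 1)) - 1 = j
    rw [ZMod.val_natCast, Nat.mod_eq_of_lt (by omega)]
    omega
  · intro i hi
    have h2 : i.val ≠ 0 := by simpa [ZMod.val_eq_zero] using hi
    rw [Nat.sub_add_cancel (Nat.pos_of_ne_zero h2), ← AddChar.map_nsmul_eq_pow]
    simp

end ZMod.shiftMat

/-! ### The Laplacian of a constant tower -/

open Matrix in
/-- The block Laplacian `2 (diag d - A) + A (2 - P - Pᵀ)`, where `d` are the row sums of `A` and `P`
is the translation by `a`. -/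
def Matrix.towerLap {V : Type*} [Fintype V] [DecidableEq V] (A : Matrix V V ℤ) {q : ℕ}
    (a : ZMod q) : Matrix V V (Matrix (ZMod q) (ZMod q) ℤ) :=
  of fun u v => (2 * (diagonal (A *ᵥ 1) - A) u v) • (1 : Matrix (ZMod q) (ZMod q) ℤ) +
    A u v • ((2 : ℤ) • 1 - ZMod.shiftMat ℤ a - (ZMod.shiftMat ℤ a)ᵀ)

/-- The number of edges between two vertices, in both directions. -/
def DiMultigraph.linkMat {V E : Type*} [DecidableEq V] [Fintype E] (D : DiMultigraph V E) :
    Matrix V V ℤ :=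
  Matrix.of fun u v => ∑ e,
    if (D.src e = u ∧ D.tgt e = v) ∨ (D.src e = v ∧ D.tgt e = u) then 1 else 0

open Matrix in
theorem DiMultigraph.one_vecMul_incMat {V E : Type*} [Fintype V] [DecidableEq V]
    (D : DiMultigraph V E) : (1 : V → ℤ) ᵥ* D.incMat = 0 := by
  ext e
  simp [vecMul, dotProduct, incMat, Finset.sum_sub_distrib]

open Matrix in
theorem DiMultigraph.derived_incMat_mul_transpose {V E : Type*} [DecidableEq V]
    [Fintype E] (D : DiMultigraph V E) {q : ℕ} [NeZero q] (a : ZMod q) (u v : V) (s t : ZMod q) :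
    ((D.derived fun _ => a).incMat * (D.derived fun _ => a).incMatᵀ) (u, s) (v, t) =
      ∑ e, (((if u = D.src e ∧ v = D.src e then 1 else 0) +
          (if u = D.tgt e ∧ v = D.tgt e then 1 else 0)) * (1 : Matrix (ZMod q) (ZMod q) ℤ) s t
        - (if u = D.src e ∧ v = D.tgt e then 1 else 0) * ZMod.shiftMat ℤ a s t
        - (if u = D.tgt e ∧ v = D.src e then 1 else 0) * ZMod.shiftMat ℤ a t s) := by
  simp only [mul_apply, transpose_apply, Fintype.sum_prod_type, incMat, of_apply, derived,
    Prod.mk.injEq, ite_and]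
  refine Finset.sum_congr rfl fun e _ => ?_
  have e1 : ∀ x y z w : ℤ,
      ∑ r : ZMod q, ((if s = r then x else 0) - (if s = r + a then y else 0)) *
        ((if t = r then z else 0) - (if t = r + a then w else 0)) =
      (x * z + y * w) * (if s = t then 1 else 0) - x * w * (if t = s + a then 1 else 0)
        - y * z * (if s = t + a then 1 else 0) := by
    intro x y z w
    have h : ∀ (x z : ℤ) (b c : ZMod q), ∑ r : ZMod q, (if s = r + b then x else 0) *
        (if t = r + c then z else 0) = x * z * (if t = s - b + c then 1 else 0) := by
      intro x z b c
      have hb : ∀ r : ZMod q, (s = r + b ↔ r = s - b) := fun r => by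
        rw [eq_sub_iff_add_eq, eq_comm]
      simp only [hb, ite_mul, zero_mul, Finset.sum_ite_eq', Finset.mem_univ, if_true]
      simp only [mul_ite, mul_zero, mul_one]
    have h00 := h x z 0 0
    have h01 := h x w 0 a
    have h10 := h y z a 0
    have h11 := h y w a a
    simp only [add_zero, sub_zero, sub_add_cancel] at h00 h01 h10 h11
    have hc : (t = s) ↔ (s = t) := eq_comm
    have hc' : (t = s - a) ↔ (s = t + a) := by rw [eq_sub_iff_add_eq, eq_comm]
    simp only [hc] at h00 h11
    simp only [hc'] at h10
    simp only [sub_mul, mul_sub, Finset.sum_sub_distrib, h00, h01, h10, h11]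
    ring
  have e2 : ∀ (P : Prop) [Decidable P] (Q : Prop) [Decidable Q],
      (if P then (if Q then (1 : ℤ) else 0) else 0) = if Q then (if P then 1 else 0) else 0 := by
    intros; split_ifs <;> rfl
  rw [Finset.sum_congr rfl fun r _ => by
    rw [e2 (u = D.src e), e2 (u = D.tgt e), e2 (v = D.src e), e2 (v = D.tgt e)]]
  rw [e1]
  simp only [ZMod.shiftMat, of_apply, one_apply]
  split_ifs <;> simp

-- An edge and its reverse contribute P and Pᵀ to each of the two off-diagonal blocks, and 2 to each
-- diagonal one. A loop is not doubled, but already contributes 2 − P − Pᵀ to its diagonal block; it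
-- cancels in diag(A1) − A.
open Matrix in
theorem DiMultigraph.double_derived_incMat_mul_transpose {V E : Type*} [Fintype V] [DecidableEq V]
    [Fintype E] (D : DiMultigraph V E) {q : ℕ} [NeZero q] (a : ZMod q) :
    (D.double.derived fun _ => a).incMat * (D.double.derived fun _ => a).incMatᵀ =
      comp V V (ZMod q) (ZMod q) ℤ (D.linkMat.towerLap a) := by
  ext ⟨u, s⟩ ⟨v, t⟩
  have hrow : ∀ u, (D.linkMat *ᵥ 1) u = ∑ e, if D.src e = u ∨ D.tgt e = u then 1 else 0 := by
    intro u
    simp only [mulVec, dotProduct, linkMat, of_apply, Pi.one_apply, mul_one]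
    rw [Finset.sum_comm]
    refine Finset.sum_congr rfl fun e _ => ?_
    by_cases h1 : D.src e = u <;> by_cases h2 : D.tgt e = u
    · simp [h1, h2, eq_comm (a := u)]
    all_goals simp [h1, h2]
  rw [derived_incMat_mul_transpose, Fintype.sum_sum_type]
  set x := (1 : Matrix (ZMod q) (ZMod q) ℤ) s t
  set y := ZMod.shiftMat ℤ a s t
  set z := ZMod.shiftMat ℤ a t s
  let blk : V → V → ℤ := fun b c =>
    ((if u = b ∧ v = b then 1 else 0) + (if u = c ∧ v = c then 1 else 0)) * x
      - (if u = b ∧ v = c then 1 else 0) * y - (if u = c ∧ v = b then 1 else 0) * z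
  change ∑ e, blk (D.src e) (D.tgt e) +
    ∑ e : {e // D.src e ≠ D.tgt e}, blk (D.tgt e) (D.src e) = _
  rw [← Finset.sum_subtype (Finset.univ.filter fun e => D.src e ≠ D.tgt e) (by simp)
    fun e => blk (D.tgt e) (D.src e), Finset.sum_filter, ← Finset.sum_add_distrib]
  have hR : comp V V (ZMod q) (ZMod q) ℤ (D.linkMat.towerLap a) (u, s) (v, t) =
      2 * ((if u = v then (D.linkMat *ᵥ 1) u else 0) - D.linkMat u v) * x +
        D.linkMat u v * (2 * x - y - z) := by
    simp only [comp_apply, towerLap, of_apply, Matrix.add_apply, Matrix.smul_apply,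
      Matrix.sub_apply, transpose_apply, smul_eq_mul, diagonal_apply, x, y, z]
  rw [hR, hrow]
  simp only [linkMat, of_apply]
  have hz : (if u = v then ∑ e, (if D.src e = u ∨ D.tgt e = u then (1 : ℤ) else 0) else 0) =
      ∑ e, if u = v then (if D.src e = u ∨ D.tgt e = u then 1 else 0) else 0 := by
    split_ifs <;> simp
  rw [hz, ← Finset.sum_sub_distrib, Finset.mul_sum, Finset.sum_mul, Finset.sum_mul,
    ← Finset.sum_add_distrib]
  refine Finset.sum_congr rfl fun e _ => ?_
  dsimp only [blk]
  generalize D.src e = b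
  generalize D.tgt e = c
  by_cases h1 : b = c
  · subst h1
    by_cases h2 : u = b
    · subst h2
      by_cases h3 : u = v
      · subst h3; simp
      · simp [h3, Ne.symm h3]
    · simp [h2, Ne.symm h2]
  · by_cases h2 : u = b
    · subst h2
      by_cases h3 : u = v
      · subst h3; simp [h1, Ne.symm h1]; ring
      · by_cases h4 : v = c
        · subst h4; simp [h1, Ne.symm h1]; ring
        · simp [h1, h3, h4, Ne.symm h1, Ne.symm h3, Ne.symm h4]
    · by_cases h3 : u = c
      · subst h3
        by_cases h4 : u = v
        · subst h4; simp [h1, h2]; ring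
        · by_cases h5 : v = b
          · subst h5; simp [h1, h2]; ring
          · simp [h1, h2, h4, h5, Ne.symm h4, Ne.symm h5]
      · simp [h1, h2, h3, Ne.symm h2, Ne.symm h3]

open Polynomial in
/-- The polynomial `(1 - X) (1 - X ^ (q - 1))`, which takes the value `(1 - z) (1 - z⁻¹)` at every
`q`-th root of unity `z`. -/
noncomputable def towerPoly (q : ℕ) : ℤ[X] := (1 - X) * (1 - X ^ (q - 1))

open Polynomial Matrix in
/-- The Laplacian of a constant tower over the ring of polynomials. -/
noncomputable def Matrix.polyLap {V : Type*} [Fintype V] [DecidableEq V] (A : Matrix V V ℤ)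
    (q : ℕ) : Matrix V V ℤ[X] :=
  Matrix.of fun u v => C (2 * (diagonal (A *ᵥ 1) - A) u v) + C (A u v) * towerPoly q

open Polynomial Matrix in
theorem aeval_towerPoly {q : ℕ} [NeZero q] (a : ZMod q) :
    aeval (ZMod.shiftMat ℤ a) (towerPoly q) =
      (2 : ℤ) • 1 - ZMod.shiftMat ℤ a - (ZMod.shiftMat ℤ a)ᵀ := by
  have h1 : ZMod.shiftMat ℤ a * (ZMod.shiftMat ℤ a)ᵀ = 1 := by
    rw [← ZMod.shiftMat.pow_card_sub_one, ← pow_succ', Nat.sub_add_cancel NeZero.one_le,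
      ZMod.shiftMat.pow_card]
  simp only [towerPoly, map_mul, map_sub, map_one, aeval_X, map_pow,
    ZMod.shiftMat.pow_card_sub_one, sub_mul, mul_sub, one_mul, mul_one, h1, two_smul]
  abel

-- Since a is a unit, its multiples run through ℤ/q exactly once. The all-ones block is thus itself
-- a polynomial in the translation.
open Polynomial Matrix in
theorem aeval_shiftMat_geom_sum {q : ℕ} [NeZero q] {a : ZMod q} (ha : IsUnit a) :
    aeval (ZMod.shiftMat ℤ a) (∑ i ∈ Finset.range q, (X : ℤ[X]) ^ i) = of fun _ _ => 1 := by
  rw [map_sum]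
  ext s t
  have hpow : ∀ n : ℕ, (ZMod.shiftMat ℤ a ^ n) s t = if t = s + n • a then 1 else 0 := by
    intro n
    rw [ZMod.shiftMat.pow_eq]
    rfl
  simp only [map_pow, aeval_X, Matrix.sum_apply, of_apply, hpow]
  obtain ⟨b, rfl⟩ := ha
  rw [Finset.sum_eq_single_of_mem ((t - s) * (b⁻¹ : (ZMod q)ˣ)).val
    (Finset.mem_range.2 (ZMod.val_lt _))]
  · simp
  · intro i hi hne
    rw [if_neg]
    intro h
    apply hne
    rw [h, add_sub_cancel_left, nsmul_eq_mul, mul_assoc, Units.mul_inv, mul_one, ZMod.val_natCast,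
      Nat.mod_eq_of_lt (Finset.mem_range.1 hi)]

section

open Polynomial Matrix

variable {V : Type*} [Fintype V] [DecidableEq V] (A : Matrix V V ℤ) (r : V)

theorem Matrix.diagonal_sub_mulVec_one : (diagonal (A *ᵥ 1) - A) *ᵥ 1 = 0 := by
  ext u
  simp [sub_mulVec, mulVec_diagonal]

theorem Matrix.one_vecMul_diagonal_sub (hA : Aᵀ = A) : 1 ᵥ* (diagonal (A *ᵥ 1) - A) = 0 := by
  conv_lhs => rw [← hA]
  rw [vecMul_sub, vecMul_transpose, hA]
  ext u
  simp [vecMul_diagonal]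

/-- At X = 1 the polynomial Laplacian becomes L = 2(diag(A1) − A), which is singular. Replacing its
column r by a vector therefore has the same determinant as adding that vector to the column, a rank
one perturbation. -/
theorem Matrix.det_polyLap_updateCol_eval_one (hA : Aᵀ = A) (q : ℕ) :
    ((A.polyLap q).updateCol r fun u => C ((A *ᵥ 1) u)).det.eval 1 =
      (∑ u, (A *ᵥ 1) u) *
        ((2 : ℤ) • (diagonal (A *ᵥ 1) - A) + vecMulVec (Pi.single r 1) (Pi.single r 1)).det := by
  set L := (2 : ℤ) • (diagonal (A *ᵥ 1) - A) with hL
  have hLe : ∀ u v, L u v = 2 * (diagonal (A *ᵥ 1) - A) u v := fun _ _ => rfl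
  have hrow : L *ᵥ 1 = 0 := by rw [hL, smul_mulVec, diagonal_sub_mulVec_one, smul_zero]
  have hcol : 1 ᵥ* L = 0 := by rw [hL, vecMul_smul, one_vecMul_diagonal_sub A hA, smul_zero]
  have h1 : ((A.polyLap q).updateCol r fun u => C ((A *ᵥ 1) u)).det.eval 1 =
      (L.updateCol r (A *ᵥ 1)).det := by
    rw [← coe_evalRingHom, RingHom.map_det]
    congr 1
    ext u v
    by_cases h : v = r
    · subst h; simp
    · simp [h, polyLap, towerPoly, hLe]
  have h2 := det_add_vecMulVec_of_sum_eq_zero L hrow hcol r (A *ᵥ 1) (Pi.single r 1)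
  have h3 : L + vecMulVec (A *ᵥ 1) (Pi.single r 1) =
      L.updateCol r ((fun u => L u r) + A *ᵥ 1) := by
    ext u v
    by_cases h : v = r
    · subst h; simp [vecMulVec_apply]
    · simp [h, vecMulVec_apply]
  have h4 : L.det = 0 := by
    by_contra hne
    have := eq_zero_of_mulVec_eq_zero hne hrow
    exact one_ne_zero (congrFun this r)
  rw [h1]
  rw [h3, det_updateCol_add, updateCol_eq_self, h4, zero_add] at h2
  rw [h2]
  simp

/-- Adding all columns to column r preserves the determinant and turns that column into `towerPoly
q` times the degree vector, since the rows of diag(A1) − A sum to zero. -/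
theorem Matrix.det_eval_polyLap (q : ℕ) {R : Type*} [CommRing R] (φ : ℤ[X] →+* R) :
    φ (A.polyLap q).det =
      φ (towerPoly q) * φ ((A.polyLap q).updateCol r fun u => C ((A *ᵥ 1) u)).det := by
  rw [← map_mul]
  congr 1
  have h := det_updateCol_sum (A.polyLap q) r 1
  simp only [Pi.one_apply, one_smul] at h
  have e : (fun k => ∑ i, A.polyLap q k i) = towerPoly q • fun u => C ((A *ᵥ 1) u) := by
    ext1 u
    have h0 := congrFun (A.diagonal_sub_mulVec_one) u
    simp only [mulVec, dotProduct, Pi.one_apply, mul_one, Pi.zero_apply] at h0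
    simp only [polyLap, of_apply, Finset.sum_add_distrib, ← Finset.sum_mul, ← map_sum,
      ← Finset.mul_sum, Pi.smul_apply, smul_eq_mul]
    rw [show (∑ i, (diagonal (A *ᵥ 1) - A) u i) = 0 from h0]
    simp [mulVec, dotProduct, mul_comm]
  rw [← h, e, det_updateCol_smul]

/-- The perturbation is by the indicator w of the fibre over r because w wᵀ commutes with
translations, so all blocks stay polynomials in P. Comparing the two products over roots of unity,
one power of q comes from ζ = 1 and two from the factors (1 − ζ)(1 − ζ⁻¹), ζ ≠ 1. -/
theorem Matrix.det_towerLap_add (hA : Aᵀ = A) {q : ℕ} [NeZero q] {a : ZMod q} (ha : IsUnit a)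
    (w : V × ZMod q → ℤ) (hw : ∀ x, w x = if x.1 = r then 1 else 0) :
    (comp V V (ZMod q) (ZMod q) ℤ (A.towerLap a) + vecMulVec w w).det * (∑ u, (A *ᵥ 1) u) *
        ((2 : ℤ) • (diagonal (A *ᵥ 1) - A) + vecMulVec (Pi.single r 1) (Pi.single r 1)).det =
      q ^ 3 * ((2 : ℤ) • (diagonal (A *ᵥ 1) - A) +
        vecMulVec (Pi.single r 1) (Pi.single r 1)).det * (aeval (ZMod.shiftMat ℤ a)
        ((A.polyLap q).updateCol r fun u => C ((A *ᵥ 1) u)).det).det := by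
  set c := ((2 : ℤ) • (diagonal (A *ᵥ 1) - A) +
    vecMulVec (Pi.single r 1) (Pi.single r 1)).det with hc
  set G := ((A.polyLap q).updateCol r fun u => C ((A *ᵥ 1) u)).det with hG
  set Φ := ∑ i ∈ Finset.range q, (X : ℤ[X]) ^ i with hΦ
  set M : Matrix V V ℤ[X] := A.polyLap q + vecMulVec (Pi.single r 1) (Pi.single r Φ) with hM
  have hblock : comp V V (ZMod q) (ZMod q) ℤ (A.towerLap a) + vecMulVec w w =
      comp V V (ZMod q) (ZMod q) ℤ (M.map (aeval (ZMod.shiftMat ℤ a)).toRingHom) := by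
    ext ⟨u, s⟩ ⟨v, t⟩
    have e : (aeval (ZMod.shiftMat ℤ a)) (M u v) = A.towerLap a u v +
        (if u = r ∧ v = r then of fun _ _ => 1 else 0) := by
      simp only [hM, Matrix.add_apply, polyLap, of_apply, map_add, map_mul, aeval_C,
        aeval_towerPoly, towerLap, Algebra.algebraMap_eq_smul_one, smul_mul_assoc, one_mul,
        vecMulVec_apply]
      refine congrArg₂ _ (congrArg₂ _ (mul_smul _ _ _).symm rfl) ?_
      rw [← aeval_shiftMat_geom_sum ha]
      by_cases h1 : u = r <;> by_cases h2 : v = r <;> simp [h1, h2, hΦ]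
    have e' := congrFun (congrFun e s) t
    simp only [comp_apply, Matrix.map_apply, Matrix.add_apply, vecMulVec_apply, hw]
    refine Eq.trans ?_ e'.symm
    rw [Matrix.add_apply]
    congr 1
    by_cases h1 : u = r <;> by_cases h2 : v = r <;> simp [h1, h2]
  -- The blocks lie in a commutative ring, so the determinant can be taken first over the blocks and
  -- then of the resulting block.
  have hdet : (comp V V (ZMod q) (ZMod q) ℤ (A.towerLap a) + vecMulVec w w).det =
      (aeval (ZMod.shiftMat ℤ a) M.det).det := by
    rw [hblock, ← det_det]
    rfl
  let ev : ZMod q → ℤ[X] →+* ℂ := fun i => eval₂RingHom (Int.castRingHom ℂ) (ZMod.stdAddChar i)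
  have hcast : ∀ f : ℤ[X], (((aeval (ZMod.shiftMat ℤ a) f).det : ℤ) : ℂ) = ∏ i, ev i f := by
    intro f
    have h1 : (((aeval (ZMod.shiftMat ℤ a) f).det : ℤ) : ℂ) =
        (aeval (ZMod.shiftMat ℂ a) (f.map (Int.castRingHom ℂ))).det := by
      rw [← ZMod.shiftMat.map_aeval]
      exact (Int.castRingHom ℂ).map_det _
    rw [h1, ZMod.shiftMat.det_aeval]
    simp only [eval_map]
    -- Multiplication by the unit permutes the characters, so the product does not depend on a.
    obtain ⟨b, rfl⟩ := ha
    exact Fintype.prod_equiv (Units.mulRight b) _ _ fun i => rfl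
  have h0 : ev 0 M.det = q * c := by
    have e1 : ev 0 M.det = ((eval 1 M.det : ℤ) : ℂ) := by
      simp [ev, eval₂_at_one]
    have e2 : eval 1 M.det = q * c := by
      set L := (2 : ℤ) • (diagonal (A *ᵥ 1) - A) with hL
      have hLe : ∀ u v, L u v = 2 * (diagonal (A *ᵥ 1) - A) u v := fun _ _ => rfl
      have hrow : L *ᵥ 1 = 0 := by rw [hL, smul_mulVec, diagonal_sub_mulVec_one, smul_zero]
      have hcol : 1 ᵥ* L = 0 := by rw [hL, vecMul_smul, one_vecMul_diagonal_sub A hA, smul_zero]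
      have := det_add_vecMulVec_of_sum_eq_zero L hrow hcol r (Pi.single r 1) (Pi.single r (q : ℤ))
      rw [← coe_evalRingHom, RingHom.map_det]
      simp only [Finset.sum_pi_single', Finset.mem_univ, if_true, one_mul] at this
      rw [hc, ← this]
      congr 1
      ext u v
      by_cases h1 : u = r <;> by_cases h2 : v = r <;>
        simp [h1, h2, hM, polyLap, towerPoly, hLe, vecMulVec_apply, hΦ, eval_finsetSum]
    rw [e1, e2, Int.cast_mul, Int.cast_natCast]
  have hpow : ∀ i : ZMod q, (ZMod.stdAddChar i : ℂ) ^ (q - 1) = ZMod.stdAddChar (-i) := by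
    intro i
    rw [← AddChar.map_nsmul_eq_pow, nsmul_eq_mul, Nat.cast_sub NeZero.one_le]
    simp
  have hi : ∀ i ∈ Finset.univ.erase (0 : ZMod q), ev i M.det =
      (1 - ZMod.stdAddChar i) * (1 - ZMod.stdAddChar (-i)) * ev i G := by
    intro i hi
    have hi0 : i ≠ 0 := Finset.ne_of_mem_erase hi
    have hψ : (ZMod.stdAddChar i : ℂ) ≠ 1 := by
      rw [← AddChar.map_zero_eq_one (ZMod.stdAddChar (N := q))]
      exact fun h => hi0 (ZMod.injective_stdAddChar h)
    -- At a nontrivial root of unity the geometric sum vanishes, so the perturbation is visible only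
    -- at ζ = 1.
    have hΦ0 : ev i Φ = 0 := by
      have : ev i Φ = ∑ j ∈ Finset.range q, (ZMod.stdAddChar i : ℂ) ^ j := by
        simp [ev, hΦ]
      rw [this, geom_sum_eq hψ, ← AddChar.map_nsmul_eq_pow]
      simp
    have e1 : ev i M.det = ev i (A.polyLap q).det := by
      rw [RingHom.map_det, RingHom.map_det]
      congr 1
      ext u v
      by_cases h2 : v = r
      · subst h2; simp [hM, vecMulVec_apply, hΦ0]
      · simp [hM, vecMulVec_apply, h2]
    rw [e1, A.det_eval_polyLap r]
    congr 1
    simp [ev, towerPoly, hpow]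
  have hneg : ∏ i ∈ Finset.univ.erase (0 : ZMod q), (1 - (ZMod.stdAddChar (-i) : ℂ)) = q := by
    rw [← ZMod.shiftMat.prod_one_sub_stdAddChar]
    exact Finset.prod_nbij' (fun i => -i) (fun i => -i) (by simp) (by simp) (by simp) (by simp)
      (by simp)
  have hG0 : ev 0 G = ((∑ u, (A *ᵥ 1) u : ℤ) : ℂ) * c := by
    have e1 : ev 0 G = ((eval 1 G : ℤ) : ℂ) := by
      simp [ev, eval₂_at_one]
    rw [e1, hG, A.det_polyLap_updateCol_eval_one r hA, Int.cast_mul]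
  have hMprod := hcast M.det
  have hGprod := hcast G
  rw [← Finset.mul_prod_erase _ _ (Finset.mem_univ (0 : ZMod q))] at hMprod hGprod
  rw [h0, Finset.prod_congr rfl hi, Finset.prod_mul_distrib, Finset.prod_mul_distrib, hneg,
    ZMod.shiftMat.prod_one_sub_stdAddChar] at hMprod
  rw [hG0] at hGprod
  rw [hdet]
  have : ((((aeval (ZMod.shiftMat ℤ a) M.det).det * (∑ u, (A *ᵥ 1) u) * c : ℤ)) : ℂ) =
      ((q ^ 3 * c * (aeval (ZMod.shiftMat ℤ a) G).det : ℤ) : ℂ) := by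
    rw [Int.cast_mul, Int.cast_mul, hMprod, Int.cast_mul _ (Matrix.det _), hGprod]
    push_cast
    ring
  exact_mod_cast this

end

/-! ### Valuations of spanning tree numbers and Iwasawa invariants -/

open Matrix in
theorem DiMultigraph.transpose_linkMat {V E : Type*} [DecidableEq V] [Fintype E]
    (D : DiMultigraph V E) : D.linkMatᵀ = D.linkMat := by
  ext u v
  simp only [linkMat, transpose_apply, of_apply]
  exact Finset.sum_congr rfl fun e _ => if_congr or_comm rfl rfl

open Matrix Polynomial in
/-- In a constant `ℤ_p`-tower over a graph whose edges are doubled, the `p`-adic valuation of the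
number of spanning trees of the `n`-th layer is `n`, provided that the sum of the degrees and the
number of spanning trees of the base are prime to `p`. -/
theorem DiMultigraph.numSpanningTrees_layer {V E : Type*} [Fintype V] [DecidableEq V] [Fintype E]
    (D : DiMultigraph V E) (r : V) (p : ℕ) [Fact p.Prime]
    (hd : ¬ (p : ℤ) ∣ ∑ u, (D.linkMat *ᵥ 1) u)
    (hc : ¬ (p : ℤ) ∣ ((2 : ℤ) • (diagonal (D.linkMat *ᵥ 1) - D.linkMat) +
      vecMulVec (Pi.single r 1) (Pi.single r 1)).det)
    (a : ℤ_[p]) (ha : IsUnit a) (n : ℕ) :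
    (D.double.layer p a n).numSpanningTrees ≠ 0 ∧
      padicValNat p (D.double.layer p a n).numSpanningTrees = n := by
  have hp : p.Prime := Fact.out
  set b : ZMod (p ^ n) := PadicInt.toZModPow n a with hb
  have hbu : IsUnit b := ha.map _
  set κ := (D.double.layer p a n).numSpanningTrees with hκ
  set Q := (D.double.derived fun _ => b).incMat with hQ
  have hmtt : (κ : ℤ) = (Q * Qᵀ + vecMulVec (Pi.single (r, 0) 1) (Pi.single (r, 0) 1)).det :=
    numSpanningTrees_eq_det (D.double.derived fun _ => b) (r, 0)
  let w : V × ZMod (p ^ n) → ℤ := fun x => if x.1 = r then 1 else 0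
  have hcol : 1 ᵥ* (Q * Qᵀ) = 0 := by
    rw [← vecMul_vecMul, one_vecMul_incMat, zero_vecMul]
  have hrow : (Q * Qᵀ) *ᵥ 1 = 0 := by
    rw [← vecMul_transpose, transpose_mul, transpose_transpose, hcol]
  have hw : ∑ x, w x = (p : ℤ) ^ n := by
    rw [Fintype.sum_prod_type_right]
    simp [w]
  -- Passing from the root (r, 0) to its whole fibre multiplies the determinant by (p^n)², which is
  -- cancelled against the p^(3n) of `h2`.
  have h1 := det_add_vecMulVec_of_sum_eq_zero (Q * Qᵀ) hrow hcol (r, 0) w w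
  rw [← hmtt, hw, hQ, double_derived_incMat_mul_transpose] at h1
  have h2 := det_towerLap_add D.linkMat r D.transpose_linkMat hbu w fun _ => rfl
  rw [h1] at h2
  set c := ((2 : ℤ) • (diagonal (D.linkMat *ᵥ 1) - D.linkMat) +
      vecMulVec (Pi.single r 1) (Pi.single r 1)).det with hcdef
  set G := ((D.linkMat.polyLap (p ^ n)).updateCol r fun u => C ((D.linkMat *ᵥ 1) u)).det with hG
  have hG1 : ¬ (p : ℤ) ∣ G.eval 1 := by
    rw [hG, det_polyLap_updateCol_eval_one _ _ D.transpose_linkMat]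
    exact (Nat.prime_iff_prime_int.1 hp).not_dvd_mul hd hc
  have hN := ZMod.shiftMat.not_dvd_det_aeval b G hG1
  set N := (aeval (ZMod.shiftMat ℤ b) G).det with hNdef
  set S := ∑ u, (D.linkMat *ᵥ 1) u with hS
  have hc0 : c ≠ 0 := fun h => hc (h ▸ dvd_zero _)
  have hS0 : S ≠ 0 := fun h => hd (h ▸ dvd_zero _)
  have hN0 : N ≠ 0 := fun h => hN (h ▸ dvd_zero _)
  have hp0 : (p : ℤ) ≠ 0 := by exact_mod_cast hp.ne_zero
  have h3 : (κ : ℤ) * S = p ^ n * N := by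
    have hne : (p : ℤ) ^ n * p ^ n * c ≠ 0 := by positivity
    apply mul_left_cancel₀ hne
    push_cast at h2
    linear_combination h2
  have hκ0 : κ ≠ 0 := by
    intro h
    rw [h, Nat.cast_zero, zero_mul] at h3
    exact mul_ne_zero (pow_ne_zero _ hp0) hN0 h3.symm
  refine ⟨hκ0, ?_⟩
  have h4 := congrArg Int.natAbs h3
  rw [Int.natAbs_mul, Int.natAbs_mul, Int.natAbs_natCast, Int.natAbs_pow, Int.natAbs_natCast] at h4
  have h5 := congrArg (padicValNat p) h4
  rw [padicValNat.mul hκ0 (Int.natAbs_ne_zero.2 hS0), padicValNat.mul (pow_ne_zero _ hp.ne_zero)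
    (Int.natAbs_ne_zero.2 hN0), padicValNat.prime_pow,
    padicValNat.eq_zero_of_not_dvd (fun h => hd (Int.natCast_dvd.2 h)),
    padicValNat.eq_zero_of_not_dvd (fun h => hN (Int.natCast_dvd.2 h))] at h5
  simpa using h5

theorem Graph.components_eq_singleton {V E : Type*} {G : Graph V E} (hG : G.IsConn) :
    G.components = {G.vertexSet} := by
  have h : ∀ x ∈ G.vertexSet, {y | y ∈ G.vertexSet ∧ G.Reach x y} = G.vertexSet := fun x hx =>
    Set.ext fun y => ⟨fun hy => hy.1, fun hy => ⟨hy, hG.2 x hx y hy⟩⟩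
  ext S
  constructor
  · rintro ⟨x, hx, rfl⟩
    exact h x hx
  · rintro rfl
    obtain ⟨x, hx⟩ := hG.1
    exact ⟨x, hx, (h x hx).symm⟩

/-- A connected constant tower whose `n`-th layer has a number of spanning trees of valuation `n`
has the Iwasawa invariants `0` and `1`. -/
theorem DiMultigraph.hasIwasawaInvariants_zero_one {V E : Type*} (D : DiMultigraph V E) (p : ℕ)
    [Fact p.Prime] (h : ∀ a : ℤ_[p], IsUnit a → ∀ n, (D.layer p a n).numSpanningTrees ≠ 0 ∧
      padicValNat p (D.layer p a n).numSpanningTrees = n) :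
    D.HasIwasawaInvariants p 0 1 := by
  have hconn : ∀ a : ℤ_[p], IsUnit a → ∀ n, (D.layer p a n).IsConn := fun a ha n =>
    isConn_of_numSpanningTrees_ne_zero (h a ha n).1
  -- All layers are connected, so the component count is constantly 1: the stable level is 0, its
  -- only component is everything, and ν = 0.
  refine ⟨?_, fun a ha => ⟨0, ⟨?_, fun _ _ => Nat.zero_le _⟩, fun C hC => ⟨0, ?_⟩⟩⟩
  · obtain ⟨⟨x, -⟩, h2⟩ := hconn 1 isUnit_one 0
    refine ⟨⟨x.1, Set.mem_univ _⟩, fun y _ z _ => ?_⟩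
    have := h2 (y, 0) (Set.mem_univ _) (z, 0) (Set.mem_univ _)
    have key : ∀ u v, (D.layer p 1 0).Reach u v → D.toGraph.Reach u.1 v.1 := by
      intro u v huv
      induction huv with
      | refl => exact Relation.ReflTransGen.refl
      | tail _ hbc ih =>
        refine ih.tail ?_
        obtain ⟨e, ⟨h1, h2⟩ | ⟨h1, h2⟩⟩ := hbc
        · exact ⟨e.1, Or.inl ⟨congrArg Prod.fst h1, congrArg Prod.fst h2⟩⟩
        · exact ⟨e.1, Or.inr ⟨congrArg Prod.fst h1, congrArg Prod.fst h2⟩⟩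
    exact key _ _ this
  · intro n _
    rw [Graph.components_eq_singleton (hconn a ha n), Graph.components_eq_singleton (hconn a ha 0),
      Set.ncard_singleton, Set.ncard_singleton]
  · rw [Graph.components_eq_singleton (hconn a ha 0)] at hC
    obtain rfl : C = Set.univ := hC
    refine Filter.Eventually.of_forall fun n => ?_
    have e : D.layerOver p a 0 Set.univ n = D.layer p a (0 + n) :=
      (D.layer p a (0 + n)).induce_vertexSet
    have := h a ha (0 + n)
    beta_reduce
    rw [e]
    refine ⟨this.1, ?_⟩
    rw [this.2]
    simp

/-! ### Volcano matrices: harmonic functions and degree sum -/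

/-- A symmetric matrix of edge multiplicities with the shape of a volcano of depth `d` over a cycle
`c` of length `k`. -/
structure IsVolcanoMatrix {W : Type*} [Fintype W] [DecidableEq W] (A : W → W → ℕ) (level : W → ℕ)
    (l d k : ℕ) (c : ZMod k → W) : Prop where
  symm : ∀ u v, A u v = A v u
  level_le : ∀ v, level v ≤ d
  level_adj : ∀ u v, A u v ≠ 0 → level u ≤ level v + 1
  flat : ∀ u v, 0 < level u → level u = level v → A u v = 0
  up : ∀ v, 0 < level v → ∑ u with level u + 1 = level v, A v u = 1
  deg_lt : ∀ v, level v < d → ∑ u, A v u = l + 1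
  deg_eq : 0 < d → ∀ v, level v = d → ∑ u, A v u = 1
  cycle_injective : Function.Injective c
  range_cycle : ∀ v, level v = 0 ↔ v ∈ Set.range c
  cycle : ∀ (i : ZMod k) u, level u = 0 →
    A (c i) u = (if u = c (i + 1) then 1 else 0) + (if u = c (i - 1) then 1 else 0)

namespace IsVolcanoMatrix

variable {W : Type*} [Fintype W] [DecidableEq W] {A : W → W → ℕ} {level : W → ℕ} {l d k : ℕ} {c : ZMod k → W}

/-- Induction from the bottom level upwards: the values at the children of v agree with w v, so
harmonicity at v leaves only the term of the parent, whose multiplicity is 1. -/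
theorem eq_parent (h : IsVolcanoMatrix A level l d k c) {K : Type*} [Field K] {w : W → K}
    (hw : ∀ u, ∑ v, (A u v : K) * (w u - w v) = 0) {u v : W} (huv : A v u ≠ 0)
    (hl : level u + 1 = level v) : w v = w u := by
  induction hn : d - level v using Nat.strong_induction_on generalizing u v with
  | _ n ih =>
    have hz : ∀ x, x ≠ u → (A v x : K) * (w v - w x) = 0 := by
      intro x hx
      by_cases h0 : A v x = 0
      · simp [h0]
      · have h1 := h.level_adj v x h0
        have h2 := h.level_adj x v (h.symm v x ▸ h0)
        rcases lt_trichotomy (level x) (level v) with h3 | h3 | h3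
        · have hup := h.up v (by omega)
          rw [← Finset.add_sum_erase _ _ (a := u) (by simp [hl])] at hup
          have hx' : A v x ≤ ∑ y ∈ ({y | level y + 1 = level v} : Finset W).erase u, A v y :=
            Finset.single_le_sum (f := fun y => A v y) (fun _ _ => Nat.zero_le _)
              (by simp only [Finset.mem_erase, Finset.mem_filter, Finset.mem_univ, true_and]
                  exact ⟨hx, by omega⟩)
          omega
        · exact absurd (h.flat v x (by omega) h3.symm) h0
        · have := h.level_le x
          rw [ih (d - level x) (by omega) (h.symm v x ▸ h0) (by omega) rfl, sub_self, mul_zero]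
    have hsum := hw v
    rw [Finset.sum_eq_single u (fun x _ hx => hz x hx) (by simp)] at hsum
    have hA : A v u = 1 := by
      have hup := h.up v (by omega)
      have : A v u ≤ ∑ y with level y + 1 = level v, A v y :=
        Finset.single_le_sum (f := fun y => A v y) (fun _ _ => Nat.zero_le _) (by simp [hl])
      omega
    rw [hA, Nat.cast_one, one_mul] at hsum
    exact sub_eq_zero.1 hsum

/-- Neighbours below the crater contribute nothing by `eq_parent`, so w is harmonic on the cycle
itself. It is then an arithmetic progression, and after k steps k times its difference is zero. -/
theorem cycle_const [NeZero k] (h : IsVolcanoMatrix A level l d k c) {K : Type*} [Field K]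
    (hk : (k : K) ≠ 0) {w : W → K} (hw : ∀ u, ∑ v, (A u v : K) * (w u - w v) = 0)
    (i : ZMod k) : w (c i) = w (c 0) := by
  have hlev : ∀ i, level (c i) = 0 := fun i => (h.range_cycle _).2 ⟨i, rfl⟩
  have hstep : ∀ i, w (c (i + 1)) - w (c i) = w (c i) - w (c (i - 1)) := by
    intro i
    have h1 : ∀ v, (A (c i) v : K) * (w (c i) - w v) =
        (if v = c (i + 1) then (w (c i) - w v) else 0) +
        (if v = c (i - 1) then (w (c i) - w v) else 0) := by
      intro v
      by_cases hv : level v = 0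
      · rw [h.cycle i v hv]
        push_cast
        split_ifs <;> ring
      · have hv' : ∀ j, v ≠ c j := fun j hj => hv (hj ▸ hlev j)
        simp only [hv', if_false, add_zero]
        by_cases h0 : A (c i) v = 0
        · simp [h0]
        · have := h.level_adj v (c i) (h.symm v _ ▸ h0)
          rw [hlev] at this
          have hv1 : level (c i) + 1 = level v := by rw [hlev]; omega
          have h0' : A v (c i) ≠ 0 := h.symm v _ ▸ h0
          rw [h.eq_parent hw h0' hv1, sub_self, mul_zero]
    have := hw (c i)
    simp only [h1, Finset.sum_add_distrib, Finset.sum_ite_eq', Finset.mem_univ, if_true] at this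
    linear_combination -this
  have hconst : ∀ n : ℕ, w (c ((n : ZMod k) + 1)) - w (c n) = w (c 1) - w (c 0) := by
    intro n
    induction n with
    | zero => simp
    | succ n ih =>
      rw [← ih]
      have := hstep ((n : ZMod k) + 1)
      rw [add_sub_cancel_right] at this
      push_cast
      exact this
  have hlin : ∀ n : ℕ, w (c n) = w (c 0) + n * (w (c 1) - w (c 0)) := by
    intro n
    induction n with
    | zero => simp
    | succ n ih =>
      push_cast
      linear_combination hconst n + ih
  have h0 := hlin k
  rw [ZMod.natCast_self] at h0
  have hδ : w (c 1) - w (c 0) = 0 := by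
    have : (k : K) * (w (c 1) - w (c 0)) = 0 := by linear_combination -h0
    exact (mul_eq_zero.1 this).resolve_left hk
  have := hlin i.val
  rw [hδ, mul_zero, add_zero, ZMod.natCast_zmod_val] at this
  exact this

/-- Harmonic functions on a volcano are constant if the length of the cycle is invertible. -/
theorem const_of_harmonic [NeZero k] (h : IsVolcanoMatrix A level l d k c) {K : Type*} [Field K]
    (hk : (k : K) ≠ 0) {w : W → K} (hw : ∀ u, ∑ v, (A u v : K) * (w u - w v) = 0) (v : W) :
    w v = w (c 0) := by
  induction hn : level v generalizing v with
  | zero =>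
    obtain ⟨i, rfl⟩ := (h.range_cycle v).1 hn
    exact h.cycle_const hk hw i
  | succ n ih =>
    have hup := h.up v (by omega)
    obtain ⟨u, hu, hA⟩ := Finset.exists_ne_zero_of_sum_ne_zero (hup.trans_ne one_ne_zero)
    rw [Finset.mem_filter] at hu
    rw [h.eq_parent hw hA hu.2, ih u (by omega)]

/-- With n_r vertices in level r, the degree conditions give n_1 = k(l − 1) and n_(r+1) = l n_r for
0 < r < d. Each crater vertex has two edge ends in the crater, and every edge down from a level is
the unique upward edge of a vertex in the next. -/
theorem sum_deg [NeZero k] (h : IsVolcanoMatrix A level l d k c) :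
    ∑ u, ∑ v, A u v = 2 * k * l ^ d := by
  let n : ℕ → ℕ := fun r => (Finset.univ.filter fun v : W => level v = r).card
  have hlev : ∀ i, level (c i) = 0 := fun i => (h.range_cycle _).2 ⟨i, rfl⟩
  have hn0 : n 0 = k := by
    have : (Finset.univ.filter fun v : W => level v = 0) = Finset.univ.image c := by
      ext v
      simp [h.range_cycle]
    simp only [n, this]
    rw [Finset.card_image_of_injective _ h.cycle_injective, Finset.card_univ, ZMod.card]
  have hn : ∀ r, n r = ∑ v : W with level v = r, 1 := fun r => Finset.card_eq_sum_ones _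
  have hdown : ∀ r, ∑ v with level v = r, ∑ u with level u = r + 1, A v u = n (r + 1) := by
    intro r
    rw [Finset.sum_comm, hn]
    refine Finset.sum_congr rfl fun u hu => ?_
    rw [Finset.mem_filter] at hu
    rw [← h.up u (by omega)]
    refine Finset.sum_congr ?_ fun v _ => h.symm v u
    ext v
    simp only [Finset.mem_filter, Finset.mem_univ, true_and]
    omega
  have hsplit : ∀ v, ∑ u, A v u = (∑ u with level u + 1 = level v, A v u) +
      (∑ u with level u = level v, A v u) + ∑ u with level u = level v + 1, A v u := by
    intro v
    simp only [Finset.sum_filter, ← Finset.sum_add_distrib]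
    refine Finset.sum_congr rfl fun u _ => ?_
    by_cases h0 : A v u = 0
    · simp [h0]
    · have h1 := h.level_adj v u h0
      have h2 := h.level_adj u v (h.symm v u ▸ h0)
      rcases (by omega : level u + 1 = level v ∨ level u = level v ∨ level u = level v + 1)
        with h3 | h3 | h3
      · rw [if_pos h3, if_neg (by omega), if_neg (by omega)]; simp
      · rw [if_neg (by omega), if_pos h3, if_neg (by omega)]; simp
      · rw [if_neg (by omega), if_neg (by omega), if_pos h3]; simp
  have hflat0 : ∀ v, level v = 0 → ∑ u with level u = level v, A v u = 2 := by
    intro v hv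
    obtain ⟨i, rfl⟩ := (h.range_cycle v).1 hv
    have e : ∀ u ∈ Finset.univ.filter (fun u => level u = level (c i)), A (c i) u =
        (if u = c (i + 1) then 1 else 0) + (if u = c (i - 1) then 1 else 0) := fun u hu =>
      h.cycle i u ((Finset.mem_filter.1 hu).2.trans hv)
    rw [Finset.sum_congr rfl e]
    rw [Finset.sum_add_distrib, Finset.sum_ite_eq', Finset.sum_ite_eq', if_pos, if_pos] <;>
      simp [hlev]
  have hflat : ∀ v, 0 < level v → ∑ u with level u = level v, A v u = 0 := fun v hv =>
    Finset.sum_eq_zero fun u hu => h.flat v u hv (Finset.mem_filter.1 hu).2.symm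
  have hup0 : ∀ v, level v = 0 → ∑ u with level u + 1 = level v, A v u = 0 := fun v hv =>
    Finset.sum_eq_zero fun u hu => by have := (Finset.mem_filter.1 hu).2; omega
  have hS0 : ∑ v with level v = 0, ∑ u, A v u = 2 * n 0 + n 1 := by
    rw [← hdown 0, hn, Finset.mul_sum, ← Finset.sum_add_distrib]
    refine Finset.sum_congr rfl fun v hv => ?_
    have hv := (Finset.mem_filter.1 hv).2
    rw [hsplit, hup0 v hv, hflat0 v hv, hv]
    ring
  have hS : ∀ r, 0 < r → ∑ v with level v = r, ∑ u, A v u = n r + n (r + 1) := by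
    intro r hr
    rw [← hdown r, hn, ← Finset.sum_add_distrib]
    refine Finset.sum_congr rfl fun v hv => ?_
    have hv := (Finset.mem_filter.1 hv).2
    rw [hsplit, h.up v (by omega), hflat v (by omega), hv]
  have hdeg : ∀ r, r < d → ∑ v with level v = r, ∑ u, A v u = n r * (l + 1) := by
    intro r hr
    rw [hn, Finset.sum_mul]
    refine Finset.sum_congr rfl fun v hv => ?_
    rw [h.deg_lt v (by rw [(Finset.mem_filter.1 hv).2]; exact hr), one_mul]
  have htot : ∑ u, ∑ v, A u v = ∑ r ∈ Finset.range (d + 1), ∑ v with level v = r, ∑ u, A v u :=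
    (Finset.sum_fiberwise_of_maps_to (fun v _ => Finset.mem_range.2 (by have := h.level_le v; omega))
      _).symm
  have hlast : n (d + 1) = 0 := by
    rw [Finset.card_eq_zero, Finset.filter_eq_empty_iff]
    intro v _
    have := h.level_le v
    omega
  have hrec : ∀ r, 0 < r → r < d → n (r + 1) = n r * l := by
    intro r h0 h1
    have := (hS r h0).symm.trans (hdeg r h1)
    linarith
  -- The second identity is n_r = k(l^r − l^(r−1)) without subtraction. The term n_r in the first
  -- stands for the edges from level r upwards, as if the volcano ended there.
  have key : ∀ r, 0 < r → r ≤ d →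
      ∑ s ∈ Finset.range r, (∑ v with level v = s, ∑ u, A v u) + n r = 2 * k * l ^ r ∧
        n r + k * l ^ (r - 1) = k * l ^ r := by
    intro r h0 hr
    induction r with
    | zero => omega
    | succ r ih =>
      rcases Nat.eq_zero_or_pos r with rfl | hr0
      · have := hdeg 0 (by omega)
        have h2 := hS0
        simp only [Finset.sum_range_one, zero_add, pow_one, Nat.sub_self, pow_zero, mul_one]
        rw [hn0] at this h2
        constructor <;> nlinarith
      · obtain ⟨h1, h2⟩ := ih hr0 (by omega)
        rw [Finset.sum_range_succ, hdeg r (by omega), hrec r hr0 (by omega)]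
        have e : l ^ r = l ^ (r - 1) * l := by
          rw [← pow_succ, Nat.sub_add_cancel hr0]
        rw [Nat.add_sub_cancel, pow_succ]
        constructor
        · nlinarith
        · calc n r * l + k * l ^ r = n r * l + k * (l ^ (r - 1) * l) := by rw [← e]
            _ = (n r + k * l ^ (r - 1)) * l := by ring
            _ = k * (l ^ r * l) := by rw [h2, mul_assoc]
  rw [htot, Finset.sum_range_succ]
  rcases Nat.eq_zero_or_pos d with hd | hd
  · subst hd
    rw [hS0, hn0, hlast]
    simp
  · rw [hS d hd, hlast, add_zero]
    exact (key d hd le_rfl).1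

end IsVolcanoMatrix

-- Otherwise there is a nonzero kernel vector modulo p. It turns out to be harmonic and to vanish at
-- c 0, hence to be zero.
open Matrix in
theorem IsVolcanoMatrix.not_dvd_det {W : Type*} [Fintype W] [DecidableEq W] {A : W → W → ℕ}
    {level : W → ℕ} {l d k : ℕ} [NeZero k] {c : ZMod k → W} (h : IsVolcanoMatrix A level l d k c)
    (B : Matrix W W ℤ) (hB : ∀ u v, B u v = A u v) (p : ℕ) [Fact p.Prime] (h2 : ¬ p ∣ 2)
    (hk : ¬ p ∣ k) :
    ¬ (p : ℤ) ∣ ((2 : ℤ) • (diagonal (B *ᵥ 1) - B) +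
      vecMulVec (Pi.single (c 0) 1) (Pi.single (c 0) 1)).det := by
  have h2' : (2 : ZMod p) ≠ 0 := by
    rw [← Nat.cast_two, Ne, ZMod.natCast_eq_zero_iff]; exact h2
  have hk' : (k : ZMod p) ≠ 0 := by rwa [Ne, ZMod.natCast_eq_zero_iff]
  rw [← ZMod.intCast_zmod_eq_zero_iff_dvd]
  intro hdet
  set M := (2 : ℤ) • (diagonal (B *ᵥ 1) - B) +
      vecMulVec (Pi.single (c 0) 1) (Pi.single (c 0) 1) with hM
  have hdet' : (M.map (Int.castRingHom (ZMod p))).det = 0 := by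
    rw [← hdet]
    exact ((Int.castRingHom (ZMod p)).map_det M).symm
  obtain ⟨w, hw0, hw⟩ := exists_mulVec_eq_zero_iff.2 hdet'
  have hrow : ∀ u, 2 * ∑ v, (A u v : ZMod p) * (w u - w v) +
      (if u = c 0 then w (c 0) else 0) = 0 := by
    intro u
    have := congrFun hw u
    simp only [mulVec, dotProduct, Pi.zero_apply] at this
    refine Eq.trans ?_ this
    have e : ∀ v, (M.map (Int.castRingHom (ZMod p))) u v * w v =
        2 * ((if u = v then (∑ x, (A u x : ZMod p)) else 0) * w v - A u v * w v) +
        (if u = c 0 then (if v = c 0 then w v else 0) else 0) := by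
      intro v
      have e1 : M u v = 2 * ((if u = v then ∑ x, (A u x : ℤ) else 0) - A u v) +
          (if u = c 0 then (if v = c 0 then 1 else 0) else 0) := by
        have : (B *ᵥ 1) u = ∑ x, (A u x : ℤ) := by simp [mulVec, dotProduct, hB]
        rw [hM, Matrix.add_apply, Matrix.smul_apply, Matrix.sub_apply, diagonal_apply, this, hB,
          vecMulVec_apply, smul_eq_mul]
        simp only [Pi.single_apply, ite_mul, one_mul, zero_mul]
      rw [Matrix.map_apply, e1]
      simp only [eq_intCast]
      push_cast
      split_ifs <;> ring
    have s1 : ∑ v, 2 * ((if u = v then (∑ x, (A u x : ZMod p)) else 0) * w v - A u v * w v) =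
        2 * ∑ v, (A u v : ZMod p) * (w u - w v) := by
      rw [← Finset.mul_sum, Finset.sum_sub_distrib]
      simp only [ite_mul, zero_mul, Finset.sum_ite_eq, Finset.mem_univ, if_true, mul_sub,
        Finset.sum_sub_distrib, Finset.sum_mul]
    have s2 : ∑ v, (if u = c 0 then (if v = c 0 then w v else 0) else 0) =
        if u = c 0 then w (c 0) else 0 := by
      split_ifs <;> simp
    rw [Finset.sum_congr rfl fun v _ => e v, Finset.sum_add_distrib, s1, s2]
  -- Summing all equations, the Laplacian part cancels by symmetry and only the root term remains.
  have hwc : w (c 0) = 0 := by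
    have hs : ∑ u, (2 * ∑ v, (A u v : ZMod p) * (w u - w v) +
      (if u = c 0 then w (c 0) else 0)) = 0 := Finset.sum_eq_zero fun u _ => hrow u
    have hanti : ∑ u, ∑ v, (A u v : ZMod p) * (w u - w v) = 0 := by
      simp only [mul_sub, Finset.sum_sub_distrib]
      rw [sub_eq_zero, Finset.sum_comm]
      exact Finset.sum_congr rfl fun u _ => Finset.sum_congr rfl fun v _ => by rw [h.symm]
    rw [Finset.sum_add_distrib, ← Finset.mul_sum, hanti, mul_zero, zero_add,
      Finset.sum_ite_eq' Finset.univ (c 0), if_pos (Finset.mem_univ _)] at hs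
    exact hs
  have hharm : ∀ u, ∑ v, (A u v : ZMod p) * (w u - w v) = 0 := by
    intro u
    have := hrow u
    rw [hwc, ite_self, add_zero] at this
    exact (mul_eq_zero.1 this).resolve_left h2'
  exact hw0 (funext fun v => (h.const_of_harmonic hk' hharm v).trans hwc)

/-! ### From abstract volcanoes to volcano matrices -/

open scoped Classical in
/-- The number of edges between two vertices of a graph with finitely many edges. -/
noncomputable def Graph.mult {V E : Type*} (X : Graph V E) [Fintype X.edgeSet]
    (u v : X.vertexSet) : ℕ :=
  ∑ e : X.edgeSet, if X.IsLink e u v then 1 else 0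

section

variable {V E : Type*} {X : Graph V E} [Fintype X.edgeSet]

theorem Graph.mult_comm (u v : X.vertexSet) : X.mult u v = X.mult v u := by
  classical
  exact Finset.sum_congr rfl fun e _ => if_congr Graph.isLink_comm rfl rfl

theorem Graph.exists_isLink_of_mult_ne_zero {u v : X.vertexSet} (h : X.mult u v ≠ 0) :
    ∃ e, X.IsLink e u v := by
  classical
  obtain ⟨e, -, he⟩ := Finset.exists_ne_zero_of_sum_ne_zero h
  exact ⟨e, by by_contra h'; exact he (if_neg h')⟩

theorem Graph.mult_eq_zero {u v : X.vertexSet} (h : ∀ e, ¬ X.IsLink e u v) : X.mult u v = 0 := by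
  by_contra h'
  obtain ⟨e, he⟩ := exists_isLink_of_mult_ne_zero h'
  exact h e he

theorem Graph.mult_eq_ncard (u v : X.vertexSet) : X.mult u v = {e | X.IsLink e u v}.ncard := by
  classical
  have : {e | X.IsLink e u v} =
      (Subtype.val : X.edgeSet → E) '' ↑(Finset.univ.filter fun e : X.edgeSet => X.IsLink e u v) := by
    ext e
    simp only [Finset.coe_filter, Finset.mem_univ, true_and, Set.mem_image, Set.mem_ofPred_eq]
    exact ⟨fun h => ⟨⟨e, h.edge_mem⟩, h, rfl⟩, by rintro ⟨e, h, rfl⟩; exact h⟩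
  rw [this, Set.ncard_image_of_injective _ Subtype.val_injective, Set.ncard_coe_finset, mult,
    Finset.sum_boole]
  rfl

theorem Graph.sum_mult [Fintype X.vertexSet] (u : X.vertexSet) :
    ∑ v, X.mult u v = X.loopOnceDegree u := by
  classical
  have : X.incidenceSet u =
      (Subtype.val : X.edgeSet → E) '' ↑(Finset.univ.filter fun e : X.edgeSet => X.Inc e u) := by
    ext e
    simp only [Finset.coe_filter, Finset.mem_univ, true_and, Set.mem_image, Set.mem_ofPred_eq,
      Graph.mem_incidenceSet]
    exact ⟨fun h => ⟨⟨e, h.edge_mem⟩, h, rfl⟩, by rintro ⟨e, h, rfl⟩; exact h⟩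
  rw [loopOnceDegree, this, Set.ncard_image_of_injective _ Subtype.val_injective,
    Set.ncard_coe_finset, Finset.card_filter]
  simp only [mult]
  rw [Finset.sum_comm]
  refine Finset.sum_congr rfl fun e _ => ?_
  split_ifs with h
  · obtain ⟨v, hv⟩ := h
    rw [Finset.sum_eq_single (⟨v, hv.right_mem⟩ : X.vertexSet), if_pos hv]
    · intro x _ hx
      rw [if_neg]
      exact fun h => hx (Subtype.ext (h.right_unique hv))
    · simp
  · exact Finset.sum_eq_zero fun v _ => if_neg fun hv => h hv.inc_left

/-- The crater edges at c i are e i and e (i − 1), distinct because k ≥ 2. For k = 2 they have the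
same other end, and the two summands add up to 2. -/
theorem Graph.mult_cycle [DecidableEq X.vertexSet] {level : V → ℕ} {k : ℕ} (hk : 2 ≤ k) (c : ZMod k → X.vertexSet)
    (e : ZMod k → E) (hc : Function.Injective c) (he : Function.Injective e)
    (hrange : Set.range e = (X.crater level).edgeSet)
    (hlink : ∀ i, (X.crater level).IsLink (e i) (c i) (c (i + 1))) (i : ZMod k) (u : X.vertexSet)
    (hu : level u = 0) : X.mult (c i) u =
      (if u = c (i + 1) then 1 else 0) + (if u = c (i - 1) then 1 else 0) := by
  classical
  have hlX : ∀ i, X.IsLink (e i) (c i) (c (i + 1)) := fun i => (hlink i).1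
  have hne : ∀ i, e i ≠ e (i - 1) := by
    intro i h
    have h1 := he h
    have : (1 : ZMod k) = 0 := by linear_combination h1
    have : Fact (1 < k) := ⟨hk⟩
    exact one_ne_zero ‹(1 : ZMod k) = 0›
  have hlX' : ∀ i, X.IsLink (e (i - 1)) (c i) (c (i - 1)) := by
    intro i
    have := (hlX (i - 1)).symm
    rwa [sub_add_cancel] at this
  have hpt : ∀ f : X.edgeSet, (if X.IsLink f (c i) u then 1 else 0) =
      (if f = ⟨e i, (hlX i).edge_mem⟩ then (if u = c (i + 1) then 1 else 0) else 0) +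
      (if f = ⟨e (i - 1), (hlX _).edge_mem⟩ then (if u = c (i - 1) then 1 else 0) else 0) := by
    intro f
    by_cases h1 : f = ⟨e i, (hlX i).edge_mem⟩
    · have h2 : f ≠ ⟨e (i - 1), (hlX _).edge_mem⟩ := fun h =>
        hne i (congrArg Subtype.val (h1.symm.trans h))
      rw [if_neg h2, if_pos h1, add_zero]
      refine if_congr ?_ rfl rfl
      subst h1
      rw [(hlX i).isLink_iff_eq, Subtype.ext_iff]
    · rw [if_neg h1, zero_add]
      by_cases h2 : f = ⟨e (i - 1), (hlX _).edge_mem⟩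
      · rw [if_pos h2]
        refine if_congr ?_ rfl rfl
        subst h2
        rw [(hlX' i).isLink_iff_eq, Subtype.ext_iff]
      · rw [if_neg h2, if_neg]
        intro h
        have hf : f.1 ∈ (X.crater level).edgeSet :=
          Graph.IsLink.edge_mem (x := (c i).1) (y := u.1) ⟨h, (hlink i).2.1, u.2, hu⟩
        rw [← hrange] at hf
        obtain ⟨j, hj⟩ := hf
        rcases (hj ▸ h).left_eq_or_eq (hlX j) with h3 | h3
        · have := hc (Subtype.ext h3)
          exact h1 (Subtype.ext (by rw [← hj, this]))
        · have := hc (Subtype.ext h3)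
          exact h2 (Subtype.ext (by rw [← hj, this, add_sub_cancel_right]))
  rw [mult, Finset.sum_congr rfl fun f _ => hpt f, Finset.sum_add_distrib, Finset.sum_ite_eq',
    Finset.sum_ite_eq', if_pos (Finset.mem_univ _), if_pos (Finset.mem_univ _)]

theorem Graph.IsAbstractVolcano.exists_isVolcanoMatrix [Fintype X.vertexSet]
    [DecidableEq X.vertexSet] {l d k : ℕ}
    {level : V → ℕ} (hX : X.IsAbstractVolcano l d level)
    (hcrater : (2 ≤ k ∧ (X.crater level).IsCycleGraph k) ∨
      (k = 1 ∧ (X.crater level).IsVertexWithLoops 2)) :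
    ∃ c : ZMod k → X.vertexSet,
      IsVolcanoMatrix X.mult (fun v => level v) l d k c := by
  classical
  suffices h : ∃ c : ZMod k → X.vertexSet, Function.Injective c ∧
      (∀ v : X.vertexSet, level v = 0 ↔ v ∈ Set.range c) ∧
      ∀ (i : ZMod k) (u : X.vertexSet), level u = 0 → X.mult (c i) u =
        (if u = c (i + 1) then 1 else 0) + (if u = c (i - 1) then 1 else 0) by
    obtain ⟨c, h1, h2, h3⟩ := h
    have hle : ∀ u v : X.vertexSet, X.mult u v ≠ 0 → level u ≤ level v + 1 := by
      intro u v h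
      obtain ⟨e, he⟩ := exists_isLink_of_mult_ne_zero h
      exact (hX.adj_level u v he.adj).1
    refine ⟨c, mult_comm, fun v => hX.level_le v v.2, hle, ?_, ?_, ?_, ?_, h1, h2, h3⟩
    · exact fun u v hu huv => mult_eq_zero fun e he => hX.totally_disconnected u v hu huv he.adj
    · intro v hv
      obtain ⟨e, ⟨u, heu, hlu⟩, huniq⟩ := hX.existsUnique_up v v.2 hv
      rw [Finset.sum_eq_single (⟨u, heu.right_mem⟩ : X.vertexSet)]
      · rw [mult_eq_ncard, Set.ncard_eq_one]
        refine ⟨e, Set.ext fun f => ⟨fun hf => huniq f ⟨u, hf, hlu⟩, ?_⟩⟩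
        rintro rfl
        exact heu
      · intro x hx hne
        refine mult_eq_zero fun f hf => hne (Subtype.ext ?_)
        have := huniq f ⟨x, hf, (Finset.mem_filter.1 hx).2⟩
        subst this
        exact hf.right_unique heu
      · intro h
        exact absurd hlu (by simpa using h)
    · intro v hv
      rw [sum_mult]
      exact hX.degree_lt (by omega) v v.2 hv
    · intro hd v hv
      rw [sum_mult]
      exact hX.degree_eq hd v v.2 hv
  rcases hcrater with ⟨hk, -, v, e, hv, hvr, he, her, hlink⟩ | ⟨rfl, ⟨v, hv⟩, -, hcard⟩
  · have hmem : ∀ i, v i ∈ X.vertexSet ∧ level (v i) = 0 := fun i => by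
      have : v i ∈ (X.crater level).vertexSet := hvr ▸ ⟨i, rfl⟩
      exact this
    refine ⟨fun i => ⟨v i, (hmem i).1⟩, fun i j h => hv (congrArg Subtype.val h), ?_, ?_⟩
    · intro x
      have : (x : V) ∈ Set.range v ↔ (x : V) ∈ X.vertexSet ∧ level x = 0 := by
        rw [hvr]; rfl
      constructor
      · intro hx
        obtain ⟨i, hi⟩ := this.2 ⟨x.2, hx⟩
        exact ⟨i, Subtype.ext hi⟩
      · rintro ⟨i, rfl⟩
        exact (hmem i).2
    · exact fun i u hu => mult_cycle hk (fun i => ⟨v i, (hmem i).1⟩) e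
        (fun i j h => hv (congrArg Subtype.val h)) he her hlink i u hu
  -- For k = 1 the vertices c (i + 1) and c (i − 1) coincide with c i, and the required multiplicity
  -- 1 + 1 is the number of loops.
  · have hiff : ∀ x, (x ∈ X.vertexSet ∧ level x = 0) ↔ x = v := fun x => Set.ext_iff.1 hv x
    have hmem := (hiff v).2 rfl
    refine ⟨fun _ => ⟨v, hmem.1⟩, fun i j _ => Subsingleton.elim i j, ?_, ?_⟩
    · intro x
      constructor
      · exact fun hx => ⟨0, Subtype.ext ((hiff x).1 ⟨x.2, hx⟩).symm⟩
      · rintro ⟨i, rfl⟩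
        exact hmem.2
    · intro i u hu
      obtain rfl : u = ⟨v, hmem.1⟩ := Subtype.ext ((hiff u).1 ⟨u.2, hu⟩)
      rw [if_pos rfl]
      refine (mult_eq_ncard _ _).trans (Eq.trans ?_ hcard)
      congr 1
      ext e
      constructor
      · exact fun h => Graph.IsLink.edge_mem (x := v) (y := v) ⟨h, hmem, hmem⟩
      · intro h
        obtain ⟨x, y, hxy⟩ := (X.crater level).exists_isLink_of_mem_edgeSet h
        have h1 := (hiff x).1 hxy.2.1
        have h2 := (hiff y).1 hxy.2.2
        subst h1
        subst h2
        exact hxy.1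

theorem DiMultigraph.IsOrientationOf.linkMat_eq [DecidableEq X.vertexSet]
    {D : DiMultigraph X.vertexSet X.edgeSet} (hD : D.IsOrientationOf) (u v : X.vertexSet) :
    D.linkMat u v = X.mult u v := by
  classical
  simp only [linkMat, Matrix.of_apply, Graph.mult]
  push_cast
  refine Finset.sum_congr rfl fun e _ => if_congr ?_ rfl rfl
  rw [(hD e).isLink_iff]
  simp only [Subtype.ext_iff]

end

/-! ### The main theorem -/

theorem mainTheorem7 {V E : Type*} (X : Graph V E) (l d k : ℕ) (level : V → ℕ)
    (hX : X.IsAbstractVolcano l d level)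
    (hcrater : (2 ≤ k ∧ (X.crater level).IsCycleGraph k) ∨
      (k = 1 ∧ (X.crater level).IsVertexWithLoops 2))
    (D : DiMultigraph X.vertexSet X.edgeSet) (hD : D.IsOrientationOf)
    (p : ℕ) [Fact p.Prime] (hp : p.Coprime (2 * k * l)) :
    D.double.HasIwasawaInvariants p 0 1 := by
  classical
  have := hX.finite_vertexSet.fintype
  have := hX.finite_edgeSet.fintype
  have hprime : p.Prime := Fact.out
  have hnd : ¬ p ∣ 2 * k * l := (Nat.Prime.coprime_iff_not_dvd hprime).1 hp
  have hk : NeZero k := ⟨by rintro rfl; simp at hnd⟩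
  obtain ⟨c, hc⟩ := hX.exists_isVolcanoMatrix hcrater
  refine DiMultigraph.hasIwasawaInvariants_zero_one _ p fun a ha n =>
    D.numSpanningTrees_layer (c 0) p ?_ ?_ a ha n
  -- The degree sum 2k l^d accounts for the condition that p does not divide l; the determinant
  -- below needs only 2 and k.
  · have : ∑ u, (D.linkMat.mulVec 1) u = ((2 * k * l ^ d : ℕ) : ℤ) := by
      rw [← hc.sum_deg]
      simp [Matrix.mulVec, dotProduct, hD.linkMat_eq]
    rw [this, Int.natCast_dvd_natCast, hprime.dvd_mul]
    rintro (h | h)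
    · exact hnd (h.mul_right l)
    · exact hnd ((hprime.dvd_of_dvd_pow h).mul_left _)
  · exact hc.not_dvd_det _ hD.linkMat_eq p (fun h => hnd ((h.mul_right k).mul_right l))
      (fun h => hnd ((h.mul_left 2).mul_right l))
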